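/- Let $\mathcal R$ be the Levi-Civita field: the functions $x:\mathbb Q\to\mathbb R$ whose support has only finitely many elements below any given rational, with pointwise sum, convolution product, and the order in which $x>0$ iff the value of $x$ at the least element of its support is positive. Identify $r\in\mathbb R$ with the element with value $r$ at $0$ and $0$ elsewhere. For $x\in\mathcal R$ let $\operatorname{sh}x=\inf\{r\in\mathbb R: x\le r\}\in[-\infty,+\infty]$. *Convergence.* $s_n\to l$ strongly if for every $\varepsilon>0$ in $\mathcal R$, $|s_n-l|<\varepsilon$ for all large $n$; $s_n\to l$ weakly if for every real $\varepsilon>0$, $\max_{q\le 1/\varepsilon}|(s_n-l)(q)|<\varepsilon$ for all large $n$. *Measurable sets.* Sequences of bounded intervals of $\mathcal R$ may contain degenerate ones; $l(I)$ is the length. A set $A\subseteq\mathcal R$ is measurable if for every $\varepsilon>0$ in $\mathcal R$ there are sequences of mutually disjoint intervals with $\bigcup I_n\subseteq A\subseteq\bigcup J_n$, $\sum l(I_n)$, $\sum l(J_n)$ strongly convergent and $\sum l(J_n)-\sum l(I_n)\le\varepsilon$. Then $m(A)$ is the supremum of the sums $\sum l(I_n)$ and the infimum of the sums $\sum l(J_n)$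 over such inner, respectively outer, sequences. *Integral in $\mathcal R$.* A function $f$ is simple on an interval $I$ with end points $\alpha\le\beta$ if for some $x_0\in[\alpha,\beta]$ and $a_n\in\mathcal R$, $f(x)=\sum_n a_n(x-x_0)^n$ as a weak limit for all $x\in I$; then $\int_I f=\lim_{x\to\beta}F(x)-\lim_{x\to\alpha}F(x)$ with $F(x)=\sum_n\frac{a_n}{n+1}(x-x_0)^{n+1}$ (and $\int_I f=0$ if $\alpha=\beta$). A function $f:A\to\mathcal R$ on a measurable set is measurable if for every $\varepsilon>0$ in $\mathcal R$ there is a sequence of mutually disjoint intervals $I_n\subseteq A$ on each of which $f$ is simple, with $\sum l(I_n)$ strongly convergent and $m(A)-\sum l(I_n)<\varepsilon$. Its integral $\int_A f\in\mathcal R$ is the limit of the strong sums $\sum_n\int_{I_n}f$ over all such sequences as $\sum l(I_n)\to m(A)$, if it exists. $L^1(A)$ is the set of measurable $f$ for which $\int_A|f|$ exists in $\mathcal R$. *$M$-integral.* A bounded $f:A\to\mathcal R$ on a measurable set is $M$-integrable if $$\sup\Bigl\{\operatorname{sh}\int_A g: g\in L^1(A),\ g\le f\text{ on }A\Bigr\}=\inf\Bigl\{\operatorname{sh}\int_A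 g: g\in L^1(A),\ g\ge f\text{ on }A\Bigr\},$$ and $\int^M_A f$ is the common value. An unbounded non-negative $f$ is $M$-integrable if the left-hand side is less than $+\infty$, and $\int_A^M f$ is that value; any other unbounded $f$ is $M$-integrable if $f^+$ and $f^-$ are, with $\int^M_A f=\int^M_A f^+-\int^M_A f^-$. *Taylor extensions.* Let $a<b$ be real numbers, $k\in\{0,1,2,\dots\}\cup\{\infty\}$, $f\in C^k([a,b])$, and $0\le h\le k$ (with $h=\infty$ allowed if $k=\infty$). Every $x\in[a,b]_{\mathcal R}=\{x\in\mathcal R:a\le x\le b\}$ is $x=r+\varepsilon$ with unique $r=\operatorname{sh}x\in[a,b]$ and $\varepsilon$ infinitesimal (possibly $0$); put $\operatorname{ext}_h f(r+\varepsilon)=\sum_{i=0}^{h}f^{(i)}(r)\,\varepsilon^i/i!$ (a weak limit if $h=\infty$), with one-sided derivatives at the end points. **Theorem.** The function $\operatorname{ext}_h f$ is $M$-integrable on $[a,b]_{\mathcal R}$, and $$\int^M_{[a,b]_{\mathcal R}}\operatorname{ext}_h f=\int_{[a,b]}f(x)\,dx,$$ the right-hand side being the Lebesgue integral. -/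

import Mathlib

open Set

noncomputable section

/-! ## The Levi-Civita field -/

/-- A set of rationals is left-finite if it has finitely many elements below every rational. -/
def LeftFinite (F : Set ℚ) : Prop := ∀ q : ℚ, {x | x ∈ F ∧ x ≤ q}.Finite

theorem LeftFinite.mono {F G : Set ℚ} (hG : LeftFinite G) (h : F ⊆ G) : LeftFinite F :=
  fun q => (hG q).subset fun _ hx => ⟨h hx.1, hx.2⟩

theorem LeftFinite.union {F G : Set ℚ} (hF : LeftFinite F) (hG : LeftFinite G) :
    LeftFinite (F ∪ G) := fun q => ((hF q).union (hG q)).subset fun _ hx =>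
  hx.1.elim (fun h => Or.inl ⟨h, hx.2⟩) fun h => Or.inr ⟨h, hx.2⟩

theorem leftFinite_singleton (a : ℚ) : LeftFinite {a} := fun _ =>
  (Set.finite_singleton a).subset fun _ hx => hx.1

theorem LeftFinite.exists_le {F : Set ℚ} (hF : LeftFinite F) : ∃ m : ℚ, ∀ x ∈ F, m ≤ x := by
  obtain ⟨m, hm⟩ := (hF 0).bddBelow
  refine ⟨min m 0, fun x hx => ?_⟩
  rcases le_total x 0 with h | h
  · exact (min_le_left _ _).trans (hm ⟨hx, h⟩)
  · exact (min_le_right _ _).trans h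

theorem LeftFinite.add {F G : Set ℚ} (hF : LeftFinite F) (hG : LeftFinite G) :
    LeftFinite {x | ∃ y ∈ F, ∃ z ∈ G, y + z = x} := by
  intro q
  obtain ⟨m, hm⟩ := hF.exists_le
  obtain ⟨n, hn⟩ := hG.exists_le
  refine (Set.Finite.image2 (fun y z : ℚ => y + z) (hF (q - n)) (hG (q - m))).subset ?_
  rintro x ⟨⟨y, hy, z, hz, rfl⟩, hx⟩
  exact ⟨y, ⟨hy, by linarith [hn z hz]⟩, z, ⟨hz, by linarith [hm y hy]⟩, rfl⟩

theorem LeftFinite.closure {S : Set ℚ} (hS : LeftFinite S) (hpos : ∀ s ∈ S, 0 < s) :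
    LeftFinite (AddSubmonoid.closure S : Set ℚ) := by
  have hnn : ∀ g ∈ AddSubmonoid.closure S, (0 : ℚ) ≤ g := fun g hg => by
    induction hg using AddSubmonoid.closure_induction with
    | mem x hx => exact (hpos x hx).le
    | zero => exact le_rfl
    | add x y _ _ hx hy => exact add_nonneg hx hy
  have hsplit : ∀ g ∈ AddSubmonoid.closure S,
      g = 0 ∨ ∃ s ∈ S, ∃ c ∈ AddSubmonoid.closure S, g = s + c := fun g hg => by
    induction hg using AddSubmonoid.closure_induction_left with
    | zero => exact Or.inl rfl
    | add_left x hx y hy _ => exact Or.inr ⟨x, hx, y, hy, rfl⟩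
  obtain ⟨m, hm0, hm⟩ : ∃ m : ℚ, 0 < m ∧ ∀ s ∈ S, m ≤ s := by
    rcases ({x | x ∈ S ∧ x ≤ 1} : Set ℚ).eq_empty_or_nonempty with h | h
    · refine ⟨1, one_pos, fun s hs => ?_⟩
      by_contra hlt
      exact (h ▸ (⟨hs, (not_le.1 hlt).le⟩ : s ∈ {x | x ∈ S ∧ x ≤ 1}) : s ∈ (∅ : Set ℚ))
    · obtain ⟨m, hmS, hmin⟩ := Set.exists_min_image _ id (hS 1) h
      refine ⟨m, hpos m hmS.1, fun s hs => ?_⟩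
      rcases le_total s 1 with h1 | h1
      · exact hmin s ⟨hs, h1⟩
      · exact hmS.2.trans h1
  have key : ∀ n : ℕ, {x | x ∈ (AddSubmonoid.closure S : Set ℚ) ∧ x ≤ n * m}.Finite := by
    intro n
    induction n with
    | zero =>
      refine (Set.finite_singleton (0 : ℚ)).subset ?_
      rintro x ⟨hx, hx0⟩
      exact le_antisymm (by simpa using hx0) (hnn x hx)
    | succ n ih =>
      refine ((Set.finite_singleton (0 : ℚ)).union
        (Set.Finite.image2 (fun y z : ℚ => y + z) (hS ((n + 1 : ℕ) * m)) ih)).subset ?_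
      rintro x ⟨hx, hxn⟩
      rcases hsplit x hx with rfl | ⟨s, hs, c, hc, rfl⟩
      · exact Or.inl rfl
      · refine Or.inr ⟨s, ⟨hs, by linarith [hnn c hc]⟩, c, ⟨hc, ?_⟩, rfl⟩
        push_cast at hxn
        linarith [hm s hs]
  intro q
  obtain ⟨n, hn⟩ := exists_nat_ge (q / m)
  exact (key n).subset fun x hx => ⟨hx.1, hx.2.trans ((div_le_iff₀ hm0).1 hn)⟩

theorem leftFinite_support_mul {x y : HahnSeries ℚ ℝ} (hx : LeftFinite x.support)
    (hy : LeftFinite y.support) : LeftFinite (x * y).support :=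
  (hx.add hy).mono fun g hg => by
    obtain ⟨i, hi, j, hj, rfl⟩ := HahnSeries.support_mul_subset hg
    exact ⟨i, hi, j, hj, rfl⟩

theorem leftFinite_support_single (a : ℚ) (r : ℝ) :
    LeftFinite (HahnSeries.single a r).support :=
  (leftFinite_singleton a).mono HahnSeries.support_single_subset

theorem leftFinite_support_inv {x : HahnSeries ℚ ℝ} (hx : LeftFinite x.support) :
    LeftFinite (x⁻¹).support := by
  by_cases h0 : x = 0
  · subst h0; simpa using hx
  have hlc : x.leadingCoeff ≠ 0 := HahnSeries.leadingCoeff_ne_zero.2 h0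
  have hu0 := HahnSeries.unit_aux x (inv_mul_cancel₀ hlc) (-x.order) (neg_add_cancel x.order)
  have hu : LeftFinite
      (1 - HahnSeries.single (-x.order) x.leadingCoeff⁻¹ * x).support := by
    rw [sub_eq_add_neg]
    refine (LeftFinite.union (leftFinite_support_single 0 1) ?_).mono
      (HahnSeries.support_add_subset _ _)
    rw [HahnSeries.support_neg]
    exact leftFinite_support_mul (leftFinite_support_single _ _) hx
  rw [HahnSeries.inv_def]
  refine leftFinite_support_mul (leftFinite_support_single _ _) ?_
  refine (hu.closure fun g hg => ?_).mono (HahnSeries.SummableFamily.support_hsum_subset.trans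
    (Set.iUnion_subset fun n => ?_))
  · by_contra hg0
    exact hg (HahnSeries.coeff_eq_zero_of_lt_orderTop
      (lt_of_le_of_lt (WithTop.coe_le_coe.2 (not_lt.1 hg0)) hu0))
  · rw [HahnSeries.SummableFamily.powers_of_orderTop_pos hu0]
    exact HahnSeries.SummableFamily.support_pow_subset_closure _ n

/-- The Levi-Civita field: the formal series `∑ x(q) d ^ q` with real coefficients, rational
exponents and left-finite support, as a subfield of the lexicographically ordered field of Hahn
series. Addition is pointwise, multiplication is convolution, and an element is positive if and
only if its leading coefficient is. -/
def leviCivita : Subfield (Lex (HahnSeries ℚ ℝ)) where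
  carrier := {x | LeftFinite (ofLex x).support}
  mul_mem' := fun hx hy => leftFinite_support_mul hx hy
  one_mem' := leftFinite_support_single 0 1
  add_mem' := fun hx hy => (LeftFinite.union hx hy).mono
    (HahnSeries.support_add_subset _ _)
  zero_mem' := by
    intro q; simp
  neg_mem' := by
    intro x hx
    simpa using hx
  inv_mem' := fun _ hx => leftFinite_support_inv hx

/-- The type of elements of the Levi-Civita field. -/
abbrev LC : Type := leviCivita

namespace LC

/-- The value `x(q)` of an element of the Levi-Civita field at a rational exponent `q`. -/
def coeff (x : LC) (q : ℚ) : ℝ := (ofLex (x : Lex (HahnSeries ℚ ℝ))).coeff q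

/-- The embedding of the real numbers in the Levi-Civita field. -/
def ofReal (r : ℝ) : LC := ⟨toLex (HahnSeries.single 0 r), leftFinite_support_single 0 r⟩

/-- The standard part, with values `+∞` and `-∞` at infinite elements: the infimum in the extended
reals of the real numbers `r` with `x ≤ r`. -/
def sh (x : LC) : EReal := sInf {y | ∃ r : ℝ, x ≤ ofReal r ∧ y = (r : EReal)}

/-! ## Convergence -/

/-- Weak convergence of a sequence. -/
def WeakLim (s : ℕ → LC) (l : LC) : Prop :=
  ∀ ε : ℝ, 0 < ε → ∃ N : ℕ, ∀ m > N, ∀ q : ℚ, (q : ℝ) ≤ ε⁻¹ → |coeff (s m - l) q| < ε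

/-- Strong convergence of a sequence: convergence in the order topology. -/
def StrongLim (s : ℕ → LC) (l : LC) : Prop :=
  ∀ ε : LC, 0 < ε → ∃ N : ℕ, ∀ m > N, |s m - l| < ε

/-- The series `∑ c n` weakly converges to `l`. -/
def HasWeakSum (c : ℕ → LC) (l : LC) : Prop :=
  WeakLim (fun m => ∑ n ∈ Finset.range m, c n) l

/-- The series `∑ c n` strongly converges to `l`. -/
def HasStrongSum (c : ℕ → LC) (l : LC) : Prop :=
  StrongLim (fun m => ∑ n ∈ Finset.range m, c n) l

open Classical in
/-- The weak sum of a series (`0` if the series does not weakly converge). -/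
def weakSum (c : ℕ → LC) : LC := if h : ∃ l, HasWeakSum c l then h.choose else 0

/-- `F x` tends to `l` in the order topology as `x` tends to `p` in `S`, `x ≠ p`. -/
def TendstoWithin (F : LC → LC) (S : Set LC) (p l : LC) : Prop :=
  ∀ ε : LC, 0 < ε → ∃ δ : LC, 0 < δ ∧ ∀ x ∈ S, 0 < |x - p| → |x - p| < δ → |F x - l| < ε

/-! ## Measurable sets -/

/-- A bounded interval with end points `lo ≤ hi`. The degenerate cases (a point, the empty set)
are included, so that a sequence of intervals can be finite. -/
structure BInterval where
  lo : LC
  hi : LC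
  lo_le_hi : lo ≤ hi
  carrier : Set LC
  isInterval : carrier = Ioo lo hi ∨ carrier = Ico lo hi ∨ carrier = Ioc lo hi ∨
    carrier = Icc lo hi

/-- The length of an interval. -/
def BInterval.length (I : BInterval) : LC := I.hi - I.lo

/-- The intervals of the sequence are mutually disjoint. -/
def MutuallyDisjoint (I : ℕ → BInterval) : Prop :=
  Pairwise fun m n => Disjoint (I m).carrier (I n).carrier

/-- Measurable subsets: those that can be approximated from inside and outside by sequences of
disjoint intervals, up to an arbitrary positive error in the field. -/
def MMeasurableSet (A : Set LC) : Prop :=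
  ∀ ε : LC, 0 < ε → ∃ (I J : ℕ → BInterval) (L M : LC),
    MutuallyDisjoint I ∧ MutuallyDisjoint J ∧
    (⋃ n, (I n).carrier) ⊆ A ∧ A ⊆ (⋃ n, (J n).carrier) ∧
    HasStrongSum (fun n => (I n).length) L ∧ HasStrongSum (fun n => (J n).length) M ∧
    M - L ≤ ε

/-- `A` is measurable and `m` is its measure: the least upper bound of the sums of lengths of
sequences of disjoint intervals contained in `A`, and the greatest lower bound of the sums of
lengths of sequences of disjoint intervals that cover `A`. -/
def HasMeasure (A : Set LC) (m : LC) : Prop :=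
  MMeasurableSet A ∧
  IsLUB {L | ∃ I : ℕ → BInterval, MutuallyDisjoint I ∧ (⋃ n, (I n).carrier) ⊆ A ∧
    HasStrongSum (fun n => (I n).length) L} m ∧
  IsGLB {L | ∃ J : ℕ → BInterval, MutuallyDisjoint J ∧ A ⊆ (⋃ n, (J n).carrier) ∧
    HasStrongSum (fun n => (J n).length) L} m

/-! ## Simple and measurable functions and their integral in the Levi-Civita field

Functions on a set `A` are represented by functions on the whole field; only their values on `A`
matter. -/

/-- On the interval `I`, `f` is the weak sum of the power series with centre `x₀` in the closure of
`I` and coefficients `a`. -/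
def IsPowerSeriesOn (f : LC → LC) (I : BInterval) (x₀ : LC) (a : ℕ → LC) : Prop :=
  x₀ ∈ Icc I.lo I.hi ∧ ∀ x ∈ I.carrier, HasWeakSum (fun n => a n * (x - x₀) ^ n) (f x)

/-- `f` is simple on `I`: it is given there by a single weakly convergent power series. -/
def IsSimpleOn (f : LC → LC) (I : BInterval) : Prop :=
  ∃ (x₀ : LC) (a : ℕ → LC), IsPowerSeriesOn f I x₀ a

/-- `v` is the integral over `I` of the simple function `f`: the difference of the limits at the
end points of the antiderivative `F(x) = ∑ a n / (n + 1) * (x - x₀) ^ (n + 1)`. -/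
def HasSimpleIntegral (f : LC → LC) (I : BInterval) (v : LC) : Prop :=
  ∃ (x₀ : LC) (a : ℕ → LC), IsPowerSeriesOn f I x₀ a ∧
    ((I.lo = I.hi ∧ v = 0) ∨
      (I.lo < I.hi ∧ ∃ (F : LC → LC) (u w : LC),
        (∀ x ∈ I.carrier, HasWeakSum (fun n => a n / ((n : LC) + 1) * (x - x₀) ^ (n + 1)) (F x)) ∧
        TendstoWithin F I.carrier I.lo u ∧ TendstoWithin F I.carrier I.hi w ∧ v = w - u))

/-- `I` is a sequence of disjoint subintervals of `A` on each of which `f` is simple, and the sum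
of the lengths strongly converges to `L`. -/
def IsSimpleFamily (A : Set LC) (f : LC → LC) (I : ℕ → BInterval) (L : LC) : Prop :=
  MutuallyDisjoint I ∧ (⋃ n, (I n).carrier) ⊆ A ∧ (∀ n, IsSimpleOn f (I n)) ∧
    HasStrongSum (fun n => (I n).length) L

/-- `f` is a measurable function on the measurable set `A`. -/
def MMeasurableFun (A : Set LC) (f : LC → LC) : Prop :=
  ∃ m, HasMeasure A m ∧ ∀ ε : LC, 0 < ε → ∃ I L, IsSimpleFamily A f I L ∧ m - L < ε

/-- `f` is measurable on `A` and its integral over `A` is the element `v` of the field: the sums of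
the integrals of `f` over sequences of disjoint subintervals of `A` where `f` is simple tend to `v`
as the total length of the intervals tends to the measure of `A`. -/
def HasIntegral (A : Set LC) (f : LC → LC) (v : LC) : Prop :=
  MMeasurableFun A f ∧ ∃ m, HasMeasure A m ∧
    ∀ ε : LC, 0 < ε → ∃ δ : LC, 0 < δ ∧ ∀ I L, IsSimpleFamily A f I L → m - L < δ →
      ∃ (c : ℕ → LC) (w : LC), (∀ n, HasSimpleIntegral f (I n) (c n)) ∧ HasStrongSum c w ∧
        |w - v| < ε

/-- The space `L¹(A)`. -/
def MemL1 (A : Set LC) (f : LC → LC) : Prop :=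
  MMeasurableFun A f ∧ ∃ v, HasIntegral A (fun x => |f x|) v

/-! ## The real-valued integral -/

/-- Supremum of the standard parts of the integrals of the `L¹` functions below `f`. -/
def lowerIntegral (A : Set LC) (f : LC → LC) : EReal :=
  sSup {y | ∃ (g : LC → LC) (v : LC),
    MemL1 A g ∧ HasIntegral A g v ∧ (∀ x ∈ A, g x ≤ f x) ∧ y = sh v}

/-- Infimum of the standard parts of the integrals of the `L¹` functions above `f`. -/
def upperIntegral (A : Set LC) (f : LC → LC) : EReal :=
  sInf {y | ∃ (g : LC → LC) (v : LC),
    MemL1 A g ∧ HasIntegral A g v ∧ (∀ x ∈ A, f x ≤ g x) ∧ y = sh v}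

/-- `f` is bounded on `A`. -/
def BoundedOn (A : Set LC) (f : LC → LC) : Prop := ∃ B : LC, ∀ x ∈ A, |f x| ≤ B

/-- Integrability of a function that is bounded or non-negative. -/
def MIntegrableAux (A : Set LC) (f : LC → LC) : Prop :=
  (BoundedOn A f → lowerIntegral A f = upperIntegral A f) ∧
  (¬ BoundedOn A f → lowerIntegral A f < ⊤)

/-- `f` is `M`-integrable on the measurable set `A`: if `f` is bounded, the lower and the upper
integral agree; otherwise, the positive and the negative part are `M`-integrable, which for an
unbounded non-negative function means that the lower integral is less than `+∞`. -/
def MIntegrable (A : Set LC) (f : LC → LC) : Prop :=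
  MMeasurableSet A ∧
  (BoundedOn A f → MIntegrableAux A f) ∧
  (¬ BoundedOn A f →
    MIntegrableAux A (fun x => max (f x) 0) ∧ MIntegrableAux A (fun x => max (-f x) 0))

open Classical in
/-- The `M`-integral of an `M`-integrable function. -/
def mIntegral (A : Set LC) (f : LC → LC) : EReal :=
  if BoundedOn A f then lowerIntegral A f
  else lowerIntegral A (fun x => max (f x) 0) - lowerIntegral A (fun x => max (-f x) 0)

/-! ## Taylor extensions -/

/-- The order `h` extension of `f : [a, b] → ℝ` to the points `x = r + ε` of the interval between
`a` and `b` in the Levi-Civita field, where `r` is the standard part of `x`: the sum over `i ≤ h`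
of `f⁽ⁱ⁾(r) / i! * ε ^ i`, a weakly convergent series for `h = ∞`. -/
def ext (a b : ℝ) (h : ℕ∞) (f : ℝ → ℝ) (x : LC) : LC :=
  weakSum fun i =>
    if (i : ℕ∞) ≤ h then
      ofReal (iteratedDerivWithin i f (Icc a b) (sh x).toReal / (i.factorial : ℝ)) *
        (x - ofReal (sh x).toReal) ^ i
    else 0

end LC

end

noncomputable section

namespace LC

open Filter Topology

/-! ## Coefficients and order -/

/-! At `x = r + ε` every Taylor term after the first carries a power of the infinitesimal `ε`, so
the extension is finite and infinitely close to `f r` (`closeOn_ext`). Derivatives then disappear: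
any `F` infinitely close to a continuous `f` in this sense (`CloseOn`) is bounded, and its lower and
upper integrals both equal `∫ f`.

Lower bound (`CloseOn.exists_le`): a step function with real nodes and real values strictly below
`f` lies below `F`, and its integral is a lower Riemann sum. To compute that integral over an
arbitrary simple family, a step function must be shown constant wherever it is simple
(`IsSimpleOn.exists_eq_const`). It takes countably many values, so one of them is taken at
uncountably many real positions, and the identity theorem applies. The sums are then increments of a
Lipschitz antiderivative, controlled by `sum_le_of_lipschitz`.

Upper bound (`CloseOn.integral_le`): Weierstrass gives a real polynomial `P` slightly above `f`,
hence above every competitor `g ≤ F`. Unlike a step function, `P` is a power series about any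
centre, so `P - g` is a nonnegative power series on each interval where `g` is simple, and no
interval has to be cut. It remains that a nonnegative simple function has a nonnegative integral
(`IsPowerSeriesOn.antideriv_le`). After rescaling to unit length, the coefficients at the least
exponent form a nonzero real power series that is nonnegative; its real integral is strictly
positive and is, up to a positive factor, the leading coefficient of the increment
(`ConvergesOn.antideriv_lt`).

The upper integral follows by applying both bounds to `-F`. That closed intervals have the expected
measure is not a compactness statement here; `length_le_of_cover` proves it by counting real
positions. -/

theorem ext_coeff {x y : LC} (h : ∀ q, coeff x q = coeff y q) : x = y :=
  Subtype.ext (HahnSeries.ext (funext h))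

theorem leftFinite_coeff (x : LC) : LeftFinite {q | coeff x q ≠ 0} := x.2

@[simp] theorem coeff_add (x y : LC) (q : ℚ) : coeff (x + y) q = coeff x q + coeff y q := rfl

@[simp] theorem coeff_neg (x : LC) (q : ℚ) : coeff (-x) q = -coeff x q := rfl

@[simp] theorem coeff_sub (x y : LC) (q : ℚ) : coeff (x - y) q = coeff x q - coeff y q := by
  rw [sub_eq_add_neg, coeff_add, coeff_neg, sub_eq_add_neg]

@[simp] theorem coeff_zero (q : ℚ) : coeff 0 q = 0 := rfl

@[simp] theorem coeff_sum {ι : Type*} (s : Finset ι) (f : ι → LC) (q : ℚ) :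
    coeff (∑ i ∈ s, f i) q = ∑ i ∈ s, coeff (f i) q :=
  map_sum (⟨⟨fun x => coeff x q, rfl⟩, fun _ _ => rfl⟩ : LC →+ ℝ) f s

theorem coeff_ofReal (r : ℝ) (q : ℚ) : coeff (ofReal r) q = if q = 0 then r else 0 := by
  unfold coeff ofReal
  simp [HahnSeries.coeff_single]

@[simp] theorem coeff_ofReal_zero (r : ℝ) : coeff (ofReal r) 0 = r := by simp [coeff_ofReal]

theorem lt_iff_coeff {x y : LC} :
    x < y ↔ ∃ i, (∀ j < i, coeff x j = coeff y j) ∧ coeff x i < coeff y i :=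
  HahnSeries.lt_iff (x : Lex (HahnSeries ℚ ℝ)) y

/-- All exponents in the support of `x` are at least `q`. -/
def OrderGE (q : ℚ) (x : LC) : Prop := ∀ p < q, coeff x p = 0

theorem OrderGE.mono {q q' : ℚ} {x : LC} (h : OrderGE q x) (hq : q' ≤ q) : OrderGE q' x :=
  fun p hp => h p (hp.trans_le hq)

theorem OrderGE.add {q : ℚ} {x y : LC} (hx : OrderGE q x) (hy : OrderGE q y) :
    OrderGE q (x + y) := fun p hp => by simp [hx p hp, hy p hp]

theorem OrderGE.neg {q : ℚ} {x : LC} (hx : OrderGE q x) : OrderGE q (-x) :=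
  fun p hp => by simp [hx p hp]

theorem OrderGE.sub {q : ℚ} {x y : LC} (hx : OrderGE q x) (hy : OrderGE q y) :
    OrderGE q (x - y) := fun p hp => by simp [hx p hp, hy p hp]

theorem orderGE_zero (q : ℚ) : OrderGE q 0 := fun _ _ => rfl

theorem orderGE_ofReal (r : ℝ) : OrderGE 0 (ofReal r) := fun p hp => by
  simp [coeff_ofReal, hp.ne]

theorem coeff_mul_eq (x y : LC) (q : ℚ) : coeff (x * y) q =
    (ofLex (x : Lex (HahnSeries ℚ ℝ)) * ofLex (y : Lex (HahnSeries ℚ ℝ))).coeff q := rfl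

theorem OrderGE.mul {p q : ℚ} {x y : LC} (hx : OrderGE p x) (hy : OrderGE q y) :
    OrderGE (p + q) (x * y) := fun r hr => by
  rw [coeff_mul_eq, HahnSeries.coeff_mul]
  refine Finset.sum_eq_zero fun ij hij => ?_
  rw [Finset.mem_antidiagonal] at hij
  exfalso
  have h1 : p ≤ ij.1 := not_lt.1 fun h => hij.1 (hx _ h)
  have h2 : q ≤ ij.2 := not_lt.1 fun h => hij.2.1 (hy _ h)
  linarith [hij.2.2]

/-- At the least possible exponent only one pair contributes to the convolution. -/
theorem coeff_mul_of_orderGE {p q : ℚ} {x y : LC} (hx : OrderGE p x) (hy : OrderGE q y) :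
    coeff (x * y) (p + q) = coeff x p * coeff y q := by
  rw [coeff_mul_eq, HahnSeries.coeff_mul]
  rw [Finset.sum_eq_single (p, q)]
  · rfl
  · intro ij hij hne
    rw [Finset.mem_antidiagonal] at hij
    exfalso
    have h1 : p ≤ ij.1 := not_lt.1 fun h => hij.1 (hx _ h)
    have h2 : q ≤ ij.2 := not_lt.1 fun h => hij.2.1 (hy _ h)
    exact hne (Prod.ext (by simp only; linarith [hij.2.2]) (by simp only; linarith [hij.2.2]))
  · intro h
    rw [Finset.mem_antidiagonal] at h
    by_contra h0
    exact h ⟨left_ne_zero_of_mul h0, right_ne_zero_of_mul h0, rfl⟩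

theorem exists_orderGE {x : LC} (hx : x ≠ 0) : ∃ q, OrderGE q x ∧ coeff x q ≠ 0 := by
  rcases lt_or_gt_of_ne hx with h | h
  · obtain ⟨i, hi, hi'⟩ := lt_iff_coeff.1 h
    exact ⟨i, fun j hj => hi j hj, hi'.ne⟩
  · obtain ⟨i, hi, hi'⟩ := lt_iff_coeff.1 h
    exact ⟨i, fun j hj => (hi j hj).symm, hi'.ne'⟩

theorem pos_of_coeff_pos {q : ℚ} {x : LC} (hx : OrderGE q x) (h : 0 < coeff x q) : 0 < x :=
  lt_iff_coeff.2 ⟨q, fun j hj => (hx j hj).symm, h⟩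

theorem coeff_nonneg {q : ℚ} {x : LC} (hx : OrderGE q x) (h : 0 ≤ x) : 0 ≤ coeff x q := by
  by_contra hlt
  have : x < 0 := lt_iff_coeff.2 ⟨q, fun j hj => hx j hj, not_le.1 hlt⟩
  exact absurd h (not_le.2 this)

theorem exists_orderGE_pos {x : LC} (hx : 0 < x) : ∃ q, OrderGE q x ∧ 0 < coeff x q := by
  obtain ⟨i, hi, hi'⟩ := lt_iff_coeff.1 hx
  exact ⟨i, fun j hj => (hi j hj).symm, hi'⟩

/-- If the leading exponent `p` of `x` were below `q`, it would also lead in `y - x` and `y + x`,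
with opposite signs, although both are nonnegative. -/
theorem OrderGE.of_abs_le {q : ℚ} {x y : LC} (hy : OrderGE q y) (h : |x| ≤ y) :
    OrderGE q x := by
  by_contra hx
  have hx0 : x ≠ 0 := fun h0 => hx (h0 ▸ orderGE_zero q)
  obtain ⟨p, hp, hp0⟩ := exists_orderGE hx0
  have hpq : p < q := not_le.1 fun h => hx (hp.mono h)
  have h1 := coeff_nonneg (hy.mono hpq.le |>.sub hp) (sub_nonneg.2 ((le_abs_self x).trans h))
  have h2 := coeff_nonneg (hy.mono hpq.le |>.add hp)
    (by linarith [(neg_abs_le x), h] : 0 ≤ y + x)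
  rw [coeff_sub, hy p hpq] at h1
  rw [coeff_add, hy p hpq] at h2
  exact hp0 (by linarith)

theorem coeff_le_coeff {q : ℚ} {x y : LC} (hx : OrderGE q x) (hy : OrderGE q y) (h : x ≤ y) :
    coeff x q ≤ coeff y q := by
  simpa using coeff_nonneg (hy.sub hx) (sub_nonneg.2 h)

theorem abs_lt_of_orderGE {q p : ℚ} {x y : LC} (hx : OrderGE q x) (hy : OrderGE p y)
    (hpq : p < q) (h : 0 < coeff y p) : |x| < y := by
  rw [abs_lt]
  constructor
  · have := pos_of_coeff_pos (hy.add (hx.mono hpq.le)) (by simpa [hx p hpq] using h)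
    linarith
  · have := pos_of_coeff_pos (hy.sub (hx.mono hpq.le)) (by simpa [hx p hpq] using h)
    linarith

/-! ## The embedding of the reals -/

/-- `ofReal` as a ring homomorphism. -/
def ofRealHom : ℝ →+* LC where
  toFun := ofReal
  map_one' := rfl
  map_zero' := ext_coeff fun q => by simp [coeff_ofReal]
  map_add' := fun r s => ext_coeff fun q => by
    simp only [coeff_ofReal, coeff_add]; split_ifs <;> simp
  map_mul' := fun r s => by
    apply Subtype.ext
    change toLex (HahnSeries.single (0 : ℚ) (r * s)) =
      toLex (HahnSeries.single (0 : ℚ) r * HahnSeries.single (0 : ℚ) s)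
    rw [HahnSeries.single_mul_single, add_zero]

@[simp] theorem ofRealHom_apply (r : ℝ) : ofRealHom r = ofReal r := rfl
@[simp] theorem ofReal_zero : ofReal 0 = 0 := map_zero ofRealHom
@[simp] theorem ofReal_one : ofReal 1 = 1 := map_one ofRealHom
theorem ofReal_add (r s : ℝ) : ofReal (r + s) = ofReal r + ofReal s := map_add ofRealHom r s
theorem ofReal_sub (r s : ℝ) : ofReal (r - s) = ofReal r - ofReal s := map_sub ofRealHom r s
theorem ofReal_neg (r : ℝ) : ofReal (-r) = -ofReal r := map_neg ofRealHom r
theorem ofReal_mul (r s : ℝ) : ofReal (r * s) = ofReal r * ofReal s := map_mul ofRealHom r s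
theorem ofReal_pow (r : ℝ) (n : ℕ) : ofReal (r ^ n) = ofReal r ^ n := map_pow ofRealHom r n
theorem ofReal_div (r s : ℝ) : ofReal (r / s) = ofReal r / ofReal s := map_div₀ ofRealHom r s
theorem ofReal_natCast (n : ℕ) : ofReal n = n := map_natCast ofRealHom n
theorem ofReal_sum {ι : Type*} (s : Finset ι) (f : ι → ℝ) :
    ofReal (∑ i ∈ s, f i) = ∑ i ∈ s, ofReal (f i) := map_sum ofRealHom f s

theorem ofReal_strictMono : StrictMono ofReal := fun r s h =>
  lt_iff_coeff.2 ⟨0, fun j hj => by simp [coeff_ofReal, hj.ne], by simpa using h⟩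

@[simp] theorem ofReal_lt {r s : ℝ} : ofReal r < ofReal s ↔ r < s := ofReal_strictMono.lt_iff_lt
@[simp] theorem ofReal_le {r s : ℝ} : ofReal r ≤ ofReal s ↔ r ≤ s := ofReal_strictMono.le_iff_le
theorem ofReal_pos {r : ℝ} (h : 0 < r) : 0 < ofReal r := by
  simpa using ofReal_lt.2 h

theorem coeff_ofReal_mul (r : ℝ) (x : LC) (q : ℚ) : coeff (ofReal r * x) q = r * coeff x q := by
  change (HahnSeries.single (0 : ℚ) r * ofLex (x : Lex (HahnSeries ℚ ℝ))).coeff q = _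
  rw [HahnSeries.coeff_single_zero_mul]
  rfl

theorem orderGE_of_mem_Icc {a b : ℝ} {x : LC} (h : x ∈ Icc (ofReal a) (ofReal b)) :
    OrderGE 0 x := by
  refine (orderGE_ofReal (max |a| |b|)).of_abs_le (abs_le.2 ⟨?_, ?_⟩)
  · rw [← ofReal_neg]
    exact le_trans (ofReal_le.2 (by linarith [neg_abs_le a, le_max_left |a| |b|])) h.1
  · exact h.2.trans (ofReal_le.2 ((le_abs_self b).trans (le_max_right _ _)))

theorem coeff_mem_Icc {a b : ℝ} {x : LC} (h : x ∈ Icc (ofReal a) (ofReal b)) :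
    coeff x 0 ∈ Icc a b :=
  ⟨by simpa using coeff_le_coeff (orderGE_ofReal a) (orderGE_of_mem_Icc h) h.1,
    by simpa using coeff_le_coeff (orderGE_of_mem_Icc h) (orderGE_ofReal b) h.2⟩

theorem lt_ofReal_of_coeff_lt {x : LC} {r : ℝ} (hx : OrderGE 0 x) (h : coeff x 0 < r) :
    x < ofReal r :=
  sub_pos.1 (pos_of_coeff_pos ((orderGE_ofReal r).sub hx) (by simpa using h))

theorem ofReal_lt_of_lt_coeff {x : LC} {r : ℝ} (hx : OrderGE 0 x) (h : r < coeff x 0) :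
    ofReal r < x :=
  sub_pos.1 (pos_of_coeff_pos (hx.sub (orderGE_ofReal r)) (by simpa using h))

/-- A real number above the exponent-zero coefficient already exceeds `x`, because it decides the
sign of the leading term; what lies at positive exponents is infinitesimal. -/
theorem sh_eq_coeff {x : LC} (hx : OrderGE 0 x) : sh x = (coeff x 0 : EReal) := by
  apply le_antisymm
  · refine EReal.le_of_forall_lt_iff_le.1 fun z hz => ?_
    have hz' : coeff x 0 < z := by exact_mod_cast hz
    exact sInf_le ⟨z, (lt_ofReal_of_coeff_lt hx hz').le, rfl⟩
  · refine le_sInf ?_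
    rintro y ⟨r, hr, rfl⟩
    have := coeff_le_coeff hx (orderGE_ofReal r) hr
    simpa using this

theorem sh_ofReal (r : ℝ) : sh (ofReal r) = r := by
  rw [sh_eq_coeff (orderGE_ofReal r), coeff_ofReal_zero]

theorem sh_mono {x y : LC} (h : x ≤ y) : sh x ≤ sh y :=
  sInf_le_sInf fun _ ⟨r, hr, he⟩ => ⟨r, h.trans hr, he⟩

theorem OrderGE.pow {x : LC} (hx : OrderGE 0 x) (n : ℕ) : OrderGE 0 (x ^ n) := by
  induction n with
  | zero => simpa using orderGE_ofReal 1
  | succ n ih => rw [pow_succ]; simpa using ih.mul hx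

theorem coeff_pow_zero {x : LC} (hx : OrderGE 0 x) (n : ℕ) :
    coeff (x ^ n) 0 = coeff x 0 ^ n := by
  induction n with
  | zero => simpa using coeff_ofReal_zero 1
  | succ n ih =>
    have := coeff_mul_of_orderGE (hx.pow n) hx
    rw [pow_succ, pow_succ, ← ih, ← this, add_zero]

/-- The element `d ^ q`. -/
def monomial (q : ℚ) : LC :=
  ⟨toLex (HahnSeries.single q 1), leftFinite_support_single q 1⟩

theorem coeff_monomial (p q : ℚ) : coeff (monomial p) q = if q = p then 1 else 0 := by
  unfold coeff monomial
  simp [HahnSeries.coeff_single]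

theorem orderGE_monomial (q : ℚ) : OrderGE q (monomial q) := fun p hp => by
  simp [coeff_monomial, hp.ne]

theorem monomial_pos (q : ℚ) : 0 < monomial q :=
  pos_of_coeff_pos (orderGE_monomial q) (by simp [coeff_monomial])

/-! ## Convergence -/

theorem WeakLim.tendsto_coeff {s : ℕ → LC} {l : LC} (h : WeakLim s l) (q : ℚ) :
    Tendsto (fun m => coeff (s m) q) atTop (𝓝 (coeff l q)) := by
  rw [Metric.tendsto_atTop]
  intro ε hε
  -- The same number is both the tolerance and the inverse of the window of exponents, so it must
  -- also be small enough for `q` to lie in the window.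
  obtain ⟨N, hN⟩ := h (min ε (|(q : ℝ)| + 1)⁻¹) (lt_min hε (by positivity))
  refine ⟨N + 1, fun m hm => ?_⟩
  have := hN m hm q ?_
  · rw [Real.dist_eq, ← coeff_sub]; exact this.trans_le (min_le_left _ _)
  · have h2 : (|(q : ℝ)| + 1) ≤ (min ε (|(q : ℝ)| + 1)⁻¹)⁻¹ := by
      rw [le_inv_comm₀ (by positivity) (lt_min hε (by positivity))]
      exact min_le_right _ _
    linarith [le_abs_self (q : ℝ)]

theorem HasWeakSum.tendsto_coeff {c : ℕ → LC} {l : LC} (h : HasWeakSum c l) (q : ℚ) :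
    Tendsto (fun m => ∑ n ∈ Finset.range m, coeff (c n) q) atTop (𝓝 (coeff l q)) := by
  simpa using WeakLim.tendsto_coeff h q

theorem HasWeakSum.unique {c : ℕ → LC} {l l' : LC} (h : HasWeakSum c l) (h' : HasWeakSum c l') :
    l = l' := ext_coeff fun q => tendsto_nhds_unique (h.tendsto_coeff q) (h'.tendsto_coeff q)

theorem strongLim_of_orderGE {s : ℕ → LC} {l : LC}
    (h : ∀ Q : ℚ, ∃ N : ℕ, ∀ m > N, OrderGE Q (s m - l)) : StrongLim s l := by
  intro ε hε
  obtain ⟨q, hq, hq0⟩ := exists_orderGE_pos hε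
  obtain ⟨N, hN⟩ := h (q + 1)
  exact ⟨N, fun m hm => abs_lt_of_orderGE (hN m hm) hq (by linarith) hq0⟩

theorem weakLim_of_orderGE {s : ℕ → LC} {l : LC}
    (h : ∀ Q : ℚ, ∃ N : ℕ, ∀ m > N, OrderGE Q (s m - l)) : WeakLim s l := by
  intro ε hε
  obtain ⟨Q, hQ⟩ := exists_rat_gt ε⁻¹
  obtain ⟨N, hN⟩ := h Q
  refine ⟨N, fun m hm q hq => ?_⟩
  rw [hN m hm q (by exact_mod_cast hq.trans_lt hQ)]
  simpa using hε

/-- Non-Archimedean completeness: each coefficient of the partial sums is eventually constant. Below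
any exponent the limit agrees with a single partial sum, which makes its support left-finite. -/
theorem exists_sum_of_orderGE {c : ℕ → LC}
    (h : ∀ Q : ℚ, ∃ N : ℕ, ∀ n ≥ N, OrderGE Q (c n)) :
    ∃ l, ∀ Q : ℚ, ∃ N : ℕ, ∀ m > N, OrderGE Q (∑ n ∈ Finset.range m, c n - l) := by
  choose N hN using h
  have key : ∀ Q q m, q < Q → N Q ≤ m →
      ∑ n ∈ Finset.range m, coeff (c n) q = ∑ n ∈ Finset.range (N Q), coeff (c n) q := by
    intro Q q m hq hm
    refine (Finset.sum_subset (Finset.range_mono hm) fun n _ hn => ?_).symm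
    exact hN Q n (not_lt.1 fun h => hn (Finset.mem_range.2 h)) q hq
  -- `OrderGE Q` controls only exponents strictly below `Q`, so exponent `q` is read off at the
  -- bound `q + 1`.
  let f : ℚ → ℝ := fun q => ∑ n ∈ Finset.range (N (q + 1)), coeff (c n) q
  have hf : ∀ Q q, q < Q → f q = coeff (∑ n ∈ Finset.range (N Q), c n) q := by
    intro Q q hq
    rw [coeff_sum, ← key Q q (max (N Q) (N (q + 1))) hq (le_max_left _ _),
      key (q + 1) q (max (N Q) (N (q + 1))) (by linarith) (le_max_right _ _)]
  have hfin : LeftFinite (Function.support f) := by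
    intro Q
    refine ((leftFinite_coeff (∑ n ∈ Finset.range (N (Q + 1)), c n)) Q).subset ?_
    rintro q ⟨hq, hqQ⟩
    refine ⟨?_, hqQ⟩
    rw [Function.mem_support, hf (Q + 1) q (by linarith)] at hq
    exact hq
  have hpwo : (Function.support f).IsPWO := by
    rw [Set.isPWO_iff_isWF, Set.isWF_iff_no_descending_seq]
    intro g hg hmem
    refine Set.infinite_range_of_injective hg.injective ((hfin (g 0)).subset ?_)
    rintro _ ⟨n, rfl⟩
    exact ⟨hmem n, hg.antitone (Nat.zero_le n)⟩
  refine ⟨⟨toLex ⟨f, hpwo⟩, hfin⟩, fun Q => ⟨N Q, fun m hm q hq => ?_⟩⟩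
  have : coeff (⟨toLex ⟨f, hpwo⟩, hfin⟩ : LC) q = f q := rfl
  rw [coeff_sub, this, hf Q q hq, coeff_sum, coeff_sum, key Q q m hq hm.le, sub_self]

theorem StrongLim.add {s t : ℕ → LC} {l k : LC} (hs : StrongLim s l) (ht : StrongLim t k) :
    StrongLim (fun n => s n + t n) (l + k) := by
  intro ε hε
  obtain ⟨N, hN⟩ := hs (ε / 2) (half_pos hε)
  obtain ⟨M, hM⟩ := ht (ε / 2) (half_pos hε)
  refine ⟨max N M, fun m hm => ?_⟩
  have h1 := hN m ((le_max_left _ _).trans_lt hm)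
  have h2 := hM m ((le_max_right _ _).trans_lt hm)
  rw [show s m + t m - (l + k) = (s m - l) + (t m - k) by ring]
  linarith [abs_add_le (s m - l) (t m - k)]

theorem StrongLim.neg {s : ℕ → LC} {l : LC} (hs : StrongLim s l) :
    StrongLim (fun n => -s n) (-l) := fun ε hε => by
  obtain ⟨N, hN⟩ := hs ε hε
  refine ⟨N, fun m hm => ?_⟩
  rw [show -s m - -l = -(s m - l) by ring, abs_neg]
  exact hN m hm

theorem WeakLim.sub {s t : ℕ → LC} {l k : LC} (hs : WeakLim s l) (ht : WeakLim t k) :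
    WeakLim (fun n => s n - t n) (l - k) := by
  intro ε hε
  have h2 : ε⁻¹ ≤ (ε / 2)⁻¹ := inv_anti₀ (half_pos hε) (by linarith)
  obtain ⟨N, hN⟩ := hs (ε / 2) (half_pos hε)
  obtain ⟨M, hM⟩ := ht (ε / 2) (half_pos hε)
  refine ⟨max N M, fun m hm q hq => ?_⟩
  have h1 := hN m ((le_max_left _ _).trans_lt hm) q (hq.trans h2)
  have h2 := hM m ((le_max_right _ _).trans_lt hm) q (hq.trans h2)
  rw [show s m - t m - (l - k) = (s m - l) - (t m - k) by ring, coeff_sub]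
  linarith [abs_sub (coeff (s m - l) q) (coeff (t m - k) q)]

theorem HasWeakSum.sub {c d : ℕ → LC} {l k : LC} (hc : HasWeakSum c l) (hd : HasWeakSum d k) :
    HasWeakSum (fun n => c n - d n) (l - k) := by
  unfold HasWeakSum
  simpa only [Finset.sum_sub_distrib] using WeakLim.sub hc hd

theorem HasWeakSum.neg {c : ℕ → LC} {l : LC} (hc : HasWeakSum c l) :
    HasWeakSum (fun n => -c n) (-l) := by
  intro ε hε
  obtain ⟨N, hN⟩ := hc ε hε
  refine ⟨N, fun m hm q hq => ?_⟩
  rw [show (fun m => ∑ n ∈ Finset.range m, -c n) m - -l =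
    -(∑ n ∈ Finset.range m, c n - l) by simp only [Finset.sum_neg_distrib]; ring, coeff_neg,
    abs_neg]
  exact hN m hm q hq

theorem HasStrongSum.neg {c : ℕ → LC} {l : LC} (hc : HasStrongSum c l) :
    HasStrongSum (fun n => -c n) (-l) := by
  unfold HasStrongSum
  simpa only [Finset.sum_neg_distrib] using StrongLim.neg hc

theorem StrongLim.le_of_forall_le {s : ℕ → LC} {l k : LC} (hs : StrongLim s l)
    (h : ∀ n, s n ≤ k) : l ≤ k := by
  by_contra hlt
  obtain ⟨N, hN⟩ := hs (l - k) (sub_pos.2 (not_le.1 hlt))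
  have := (abs_lt.1 (hN (N + 1) N.lt_succ_self)).1
  linarith [h (N + 1)]

theorem HasStrongSum.sum_le {c : ℕ → LC} {l : LC} (hs : HasStrongSum c l) (h : ∀ n, 0 ≤ c n)
    (s : Finset ℕ) : ∑ n ∈ s, c n ≤ l := by
  by_contra hlt
  obtain ⟨N, hN⟩ := hs (∑ n ∈ s, c n - l) (sub_pos.2 (not_le.1 hlt))
  obtain ⟨K, hK⟩ := s.exists_nat_subset_range
  have h1 := (abs_lt.1 (hN (N + K + 1) (by omega))).2
  have h2 : ∑ n ∈ s, c n ≤ ∑ n ∈ Finset.range (N + K + 1), c n :=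
    Finset.sum_le_sum_of_subset_of_nonneg
      (hK.trans (Finset.range_mono (by omega))) fun n _ _ => h n
  linarith

theorem weakLim_of_eventually_eq {s : ℕ → LC} {l : LC} (N : ℕ) (h : ∀ m > N, s m = l) :
    WeakLim s l := fun ε hε => ⟨N, fun m hm q _ => by simpa [h m hm] using hε⟩

theorem strongLim_of_eventually_eq {s : ℕ → LC} {l : LC} (N : ℕ) (h : ∀ m > N, s m = l) :
    StrongLim s l := fun ε hε => ⟨N, fun m hm => by simpa [h m hm] using hε⟩

theorem sum_range_eq_of_forall_ge {c : ℕ → LC} {N : ℕ} (h : ∀ n ≥ N, c n = 0) {m : ℕ}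
    (hm : N ≤ m) : ∑ n ∈ Finset.range m, c n = ∑ n ∈ Finset.range N, c n :=
  (Finset.sum_subset (Finset.range_mono hm) fun n _ hn =>
    h n (not_lt.1 fun h => hn (Finset.mem_range.2 h))).symm

theorem hasWeakSum_of_forall_ge {c : ℕ → LC} {N : ℕ} (h : ∀ n ≥ N, c n = 0) :
    HasWeakSum c (∑ n ∈ Finset.range N, c n) :=
  weakLim_of_eventually_eq N fun _ hm => sum_range_eq_of_forall_ge h hm.le

theorem hasStrongSum_of_forall_ge {c : ℕ → LC} {N : ℕ} (h : ∀ n ≥ N, c n = 0) :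
    HasStrongSum c (∑ n ∈ Finset.range N, c n) :=
  strongLim_of_eventually_eq N fun _ hm => sum_range_eq_of_forall_ge h hm.le

/-- The terms of a strongly convergent series tend to zero. -/
theorem HasStrongSum.exists_abs_lt {c : ℕ → LC} {l : LC} (hc : HasStrongSum c l) {ε : LC}
    (hε : 0 < ε) : ∃ N, ∀ n ≥ N, |c n| < ε := by
  obtain ⟨N, hN⟩ := hc (ε / 2) (half_pos hε)
  refine ⟨N + 1, fun n hn => ?_⟩
  have h1 := hN n hn
  have h2 := hN (n + 1) (by omega)
  simp only [Finset.sum_range_succ] at h1 h2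
  rw [abs_lt] at *
  constructor <;> linarith

theorem exists_hasStrongSum {c : ℕ → LC} (h : ∀ ε > 0, ∃ N, ∀ n ≥ N, |c n| < ε) :
    ∃ l, HasStrongSum c l := by
  obtain ⟨l, hl⟩ := exists_sum_of_orderGE (c := c) fun Q => by
    obtain ⟨N, hN⟩ := h _ (monomial_pos Q)
    exact ⟨N, fun n hn => (orderGE_monomial Q).of_abs_le (hN n hn).le⟩
  exact ⟨l, strongLim_of_orderGE hl⟩

/-! ## Real power series -/

section RealPowerSeries

variable {c : ℕ → ℝ} {t : ℝ}

/-- The power series with coefficients `c` converges at every point of `(-t, 1 - t)`. -/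
def ConvergesOn (c : ℕ → ℝ) (t : ℝ) : Prop :=
  ∀ s ∈ Ioo (-t) (1 - t), ∃ l, Tendsto (fun m => ∑ n ∈ Finset.range m, c n * s ^ n) atTop (𝓝 l)

/-- The interval is not symmetric about the centre, but convergence at a point of its longer side
gives absolute convergence at every point of smaller modulus. -/
theorem ConvergesOn.summable (h : ConvergesOn c t) (ht : t ∈ Icc (0 : ℝ) 1) {s : ℝ}
    (hs : |s| < max t (1 - t)) : Summable fun n => c n * s ^ n := by
  obtain ⟨u, hu, hsu⟩ : ∃ u ∈ Ioo (-t) (1 - t), |s| < |u| := by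
    have h0 := abs_nonneg s
    rcases lt_max_iff.1 hs with h1 | h1
    · refine ⟨-((|s| + t) / 2), ⟨by linarith, by linarith [ht.2]⟩, ?_⟩
      rw [abs_neg, abs_of_nonneg (show 0 ≤ (|s| + t) / 2 by linarith)]
      linarith
    · refine ⟨(|s| + (1 - t)) / 2, ⟨by linarith [ht.1], by linarith⟩, ?_⟩
      rw [abs_of_nonneg (show 0 ≤ (|s| + (1 - t)) / 2 by linarith)]
      linarith
  obtain ⟨l, hl⟩ := h u hu
  exact summable_powerSeries_of_norm_lt hl.cauchySeq hsu

theorem abs_lt_max {s : ℝ} (hs : s ∈ Ioo (-t) (1 - t)) : |s| < max t (1 - t) :=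
  abs_lt.2 ⟨by linarith [hs.1, le_max_left t (1 - t)], hs.2.trans_le (le_max_right _ _)⟩

theorem half_le_max (t : ℝ) : 1 / 2 ≤ max t (1 - t) := by
  rcases le_total t (1 - t) with h | h
  · rw [max_eq_right h]; linarith
  · rw [max_eq_left h]; linarith

theorem ConvergesOn.hasFPowerSeriesOnBall (h : ConvergesOn c t) (ht : t ∈ Icc (0 : ℝ) 1) :
    HasFPowerSeriesOnBall (fun s => ∑' n, c n * s ^ n)
      (FormalMultilinearSeries.ofScalars ℝ c) 0 (ENNReal.ofReal (max t (1 - t))) := by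
  have hR : 0 < max t (1 - t) := lt_of_lt_of_le (by norm_num) (half_le_max t)
  have hrad : ENNReal.ofReal (max t (1 - t)) ≤ (FormalMultilinearSeries.ofScalars ℝ c).radius := by
    refine ENNReal.le_of_forall_nnreal_lt fun r hr => ?_
    refine FormalMultilinearSeries.le_radius_of_summable_norm _ ?_
    have hr' : |(r : ℝ)| < max t (1 - t) := by
      rw [NNReal.abs_eq]
      exact (ENNReal.coe_lt_ofReal).1 hr
    simpa [FormalMultilinearSeries.ofScalars_norm, abs_mul] using (h.summable ht hr').abs
  have hpos : 0 < ENNReal.ofReal (max t (1 - t)) := ENNReal.ofReal_pos.2 hR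
  have := (FormalMultilinearSeries.hasFPowerSeriesOnBall _ (hpos.trans_le hrad)).mono hpos hrad
  convert! this using 1
  ext s
  exact (FormalMultilinearSeries.ofScalars_sum_eq c s).symm

/-- A real power series with uncountably many zeros in an interval of convergence vanishes. -/
theorem ConvergesOn.eq_zero_of_not_countable (h : ConvergesOn c t) (ht : t ∈ Icc (0 : ℝ) 1)
    {Z : Set ℝ} (hZ : ¬ Z.Countable) (hsub : Z ⊆ Ioo (-t) (1 - t))
    (hzero : ∀ s ∈ Z, Tendsto (fun m => ∑ n ∈ Finset.range m, c n * s ^ n) atTop (𝓝 0)) :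
    c = 0 := by
  have hR : 0 < max t (1 - t) := lt_of_lt_of_le (by norm_num) (half_le_max t)
  have hF := h.hasFPowerSeriesOnBall ht
  by_contra hc
  rw [← FormalMultilinearSeries.ofScalars_series_eq_zero (𝕜 := ℝ) ℝ] at hc
  have han := hF.analyticOnNhd
  set U := Metric.eball (0 : ℝ) (ENNReal.ofReal (max t (1 - t))) with hU
  have hUb : U = Metric.ball 0 (max t (1 - t)) := Metric.eball_ofReal
  obtain ⟨x, hxU, hx⟩ : ∃ x ∈ U, (∑' n, c n * x ^ n) ≠ 0 := by
    by_contra! hall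
    refine hc (hF.hasFPowerSeriesAt.eq_zero_of_eventually ?_)
    filter_upwards [Metric.ball_mem_nhds (0 : ℝ) hR] with y hy
    exact hall y (hUb ▸ hy)
  -- Identity theorem: on the connected ball, the zeros of a nonzero analytic function form a
  -- discrete set, which is countable in a Lindelöf space.
  have hcod := han.preimage_zero_mem_codiscreteWithin hx hxU
    (by rw [hUb]; exact (convex_ball _ _).isConnected ⟨0, Metric.mem_ball_self hR⟩)
  have hdisc := isDiscrete_of_codiscreteWithin (U := U)
    (s := (fun s => ∑' n, c n * s ^ n) ⁻¹' {0}) hcod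
  refine hZ (((HereditarilyLindelofSpace.isLindelof _).countable_of_isDiscrete hdisc).mono ?_)
  intro s hs
  have hsR := abs_lt_max (hsub hs)
  exact ⟨tendsto_nhds_unique (h.summable ht hsR).hasSum.tendsto_sum_nat (hzero s hs), by
    rw [hUb]; simpa using hsR⟩

theorem ConvergesOn.hasDerivAt (h : ConvergesOn c t) (ht : t ∈ Icc (0 : ℝ) 1) {x : ℝ}
    (hx : |x| < max t (1 - t)) : HasDerivAt (fun s => ∑' n, c n / (n + 1) * s ^ (n + 1))
      (∑' n, c n * x ^ n) x := by
  obtain ⟨r, hxr, hr⟩ := exists_between hx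
  have hr0 : 0 < r := (abs_nonneg x).trans_lt hxr
  have hsum := (h.summable ht (s := r) (by rwa [abs_of_pos hr0])).abs
  refine hasDerivAt_tsum_of_isPreconnected (g := fun n s => c n / (n + 1) * s ^ (n + 1))
    (g' := fun n s => c n * s ^ n) (u := fun n => |c n * r ^ n|)
    (t := Metric.ball (0 : ℝ) r) (y₀ := (0 : ℝ))
    hsum Metric.isOpen_ball (convex_ball _ _).isPreconnected
    (fun n y _ => ?_) (fun n y hy => ?_) (Metric.mem_ball_self hr0) ?_ (by simpa using hxr)
  · have := (hasDerivAt_pow (n + 1) y).const_mul (c n / (n + 1))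
    have h1 : (n : ℝ) + 1 ≠ 0 := by positivity
    rw [Nat.add_sub_cancel, Nat.cast_add_one, ← mul_assoc, div_mul_cancel₀ _ h1] at this
    exact this
  · rw [Real.norm_eq_abs, abs_mul, abs_mul, abs_pow, abs_pow, abs_of_pos hr0]
    have : |y| ≤ r := by simpa using (mem_ball_zero_iff.1 hy).le
    gcongr
  · simp

/-- Abel's limit theorem along the segment from `0` to `u`. The exponents are `n + 1` where Abel's
theorem has `n`, whence the extra factor `x`. -/
theorem ConvergesOn.tendsto_antideriv {u A : ℝ}
    (hA : Tendsto (fun m => ∑ n ∈ Finset.range m, c n / (n + 1) * u ^ (n + 1)) atTop (𝓝 A)) :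
    Tendsto (fun x => ∑' n, c n / (n + 1) * (x * u) ^ (n + 1)) (𝓝[<] 1) (𝓝 A) := by
  have h1 := Real.tendsto_tsum_powerSeries_nhdsWithin_lt hA
  have h2 : Tendsto (fun x : ℝ => x) (𝓝[<] 1) (𝓝 1) := tendsto_id.mono_left nhdsWithin_le_nhds
  have := h2.mul h1
  rw [one_mul] at this
  refine this.congr fun x => ?_
  rw [← tsum_mul_left]
  congr 1
  ext n
  rw [mul_pow]
  ring

/-- Strict positivity of the integral of a nonnegative, nonzero real power series over
`[-t, 1 - t]`, where the antiderivative may converge only conditionally at the end points. -/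
theorem ConvergesOn.antideriv_lt (h : ConvergesOn c t) (ht : t ∈ Icc (0 : ℝ) 1) (hc : c ≠ 0)
    (hnn : ∀ s ∈ Ioo (-t) (1 - t), ∀ l,
      Tendsto (fun m => ∑ n ∈ Finset.range m, c n * s ^ n) atTop (𝓝 l) → 0 ≤ l) {A B : ℝ}
    (hA : Tendsto (fun m => ∑ n ∈ Finset.range m, c n / (n + 1) * (-t) ^ (n + 1)) atTop (𝓝 A))
    (hB : Tendsto (fun m => ∑ n ∈ Finset.range m, c n / (n + 1) * (1 - t) ^ (n + 1)) atTop
      (𝓝 B)) : A < B := by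
  set p : ℝ → ℝ := fun s => ∑' n, c n * s ^ n with hp
  set P : ℝ → ℝ := fun s => ∑' n, c n / (n + 1) * s ^ (n + 1) with hP
  have hsum : ∀ {s : ℝ}, |s| < max t (1 - t) →
      Tendsto (fun m => ∑ n ∈ Finset.range m, c n * s ^ n) atTop (𝓝 (p s)) :=
    fun hs => (h.summable ht hs).hasSum.tendsto_sum_nat
  have hin : ∀ x ∈ Ico (0 : ℝ) 1, |x * (1 - t)| < max t (1 - t) ∧ |x * (-t)| < max t (1 - t) := by
    intro x hx
    rw [abs_mul, abs_mul, abs_neg, abs_of_nonneg hx.1, abs_of_nonneg ht.1,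
      abs_of_nonneg (sub_nonneg.2 ht.2)]
    have hR : 0 < max t (1 - t) := lt_of_lt_of_le (by norm_num) (half_le_max t)
    have h1 := mul_le_mul_of_nonneg_left (le_max_right t (1 - t)) hx.1
    have h2 := mul_le_mul_of_nonneg_left (le_max_left t (1 - t)) hx.1
    have h3 := mul_lt_mul_of_pos_right hx.2 hR
    constructor <;> linarith
  -- Both ends are treated at once: the integral over the interval shrunk by the factor `x` about
  -- the centre is `0` at `x = 0` and tends to `B - A` as `x → 1`.
  have hd : ∀ x ∈ Ico (0 : ℝ) 1, HasDerivAt (fun x => P (x * (1 - t)) - P (x * (-t)))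
      (p (x * (1 - t)) * (1 - t) - p (x * (-t)) * (-t)) x := by
    intro x hx
    have e : ∀ u : ℝ, HasDerivAt (fun x => x * u) u x := fun u => by
      simpa using (hasDerivAt_id x).mul_const u
    exact ((h.hasDerivAt ht (hin x hx).1).comp x (e (1 - t))).sub
      ((h.hasDerivAt ht (hin x hx).2).comp x (e (-t)))
  -- The factor `1 - t` is kept because for `t = 1` the point is `0`, outside the open interval
  -- where nonnegativity is known.
  have hp1 : ∀ x ∈ Ioo (0 : ℝ) 1, 0 ≤ p (x * (1 - t)) * (1 - t) := by
    intro x hx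
    rcases ht.2.eq_or_lt with h1 | h1
    · simp [h1]
    have h4 : 0 < 1 - t := by linarith
    exact mul_nonneg (hnn _ ⟨by nlinarith [ht.1, hx.1], by nlinarith [hx.2]⟩ _
      (hsum (hin x ⟨hx.1.le, hx.2⟩).1)) h4.le
  have hp2 : ∀ x ∈ Ioo (0 : ℝ) 1, 0 ≤ p (x * (-t)) * t := by
    intro x hx
    rcases ht.1.eq_or_lt with h1 | h1
    · simp [← h1]
    exact mul_nonneg (hnn _ ⟨by nlinarith [hx.2], by nlinarith [ht.2, hx.1]⟩ _
      (hsum (hin x ⟨hx.1.le, hx.2⟩).2)) h1.le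
  have hmono : MonotoneOn (fun x => P (x * (1 - t)) - P (x * (-t))) (Ico 0 1) := by
    refine monotoneOn_of_deriv_nonneg (convex_Ico 0 1)
      (fun x hx => (hd x hx).continuousAt.continuousWithinAt) (fun x hx => ?_) fun x hx => ?_
    · rw [interior_Ico] at hx
      exact (hd x ⟨hx.1.le, hx.2⟩).differentiableAt.differentiableWithinAt
    · rw [interior_Ico] at hx
      rw [(hd x ⟨hx.1.le, hx.2⟩).deriv]
      linarith [hp1 x hx, hp2 x hx]
  have hlim : Tendsto (fun x => P (x * (1 - t)) - P (x * (-t))) (𝓝[<] 1) (𝓝 (B - A)) :=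
    (ConvergesOn.tendsto_antideriv hB).sub (ConvergesOn.tendsto_antideriv hA)
  have hle : P (1 / 2 * (1 - t)) - P (1 / 2 * (-t)) ≤ B - A := by
    refine ge_of_tendsto hlim ?_
    filter_upwards [Ioo_mem_nhdsLT (show (1 / 2 : ℝ) < 1 by norm_num)] with x hx
    exact hmono ⟨by norm_num, by norm_num⟩ ⟨by linarith [hx.1], hx.2⟩ hx.1.le
  have hH0 : P (0 * (1 - t)) - P (0 * (-t)) = 0 := by simp
  by_contra hAB
  -- If `B ≤ A`, the monotone function is squeezed to zero on half the range, so its derivative, a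
  -- sum of two nonnegative terms, vanishes there.
  have hconst : ∀ x ∈ Icc (0 : ℝ) (1 / 2), P (x * (1 - t)) - P (x * (-t)) = 0 := by
    intro x hx
    apply le_antisymm
    · have := hmono (a := x) (b := 1 / 2) ⟨hx.1, by linarith [hx.2]⟩ ⟨by norm_num, by norm_num⟩ hx.2
      simp only at this
      linarith [not_lt.1 hAB]
    · have := hmono (a := 0) (b := x) ⟨by norm_num, by norm_num⟩ ⟨hx.1, by linarith [hx.2]⟩ hx.1
      simp only at this
      linarith
  have hzero : ∀ x ∈ Ioo (0 : ℝ) (1 / 2), p (x * (1 - t)) * (1 - t) = 0 ∧ p (x * (-t)) * t = 0 := by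
    intro x hx
    have hx1 : x ∈ Ioo (0 : ℝ) 1 := ⟨hx.1, by linarith [hx.2]⟩
    have h1 : HasDerivAt (fun x => P (x * (1 - t)) - P (x * (-t))) 0 x := by
      refine (hasDerivAt_const x (0 : ℝ)).congr_of_eventuallyEq ?_
      filter_upwards [Ioo_mem_nhds hx.1 hx.2] with y hy
      exact hconst y ⟨hy.1.le, hy.2.le⟩
    have h2 := (hd x ⟨hx1.1.le, hx1.2⟩).unique h1
    have h3 := hp1 x hx1
    have h4 := hp2 x hx1
    constructor <;> linarith
  have hunc : ¬ (Ioo (0 : ℝ) (1 / 2)).Countable := by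
    rw [Cardinal.Real.Ioo_countable_iff]
    norm_num
  -- At least one side of the centre has positive length; it supplies uncountably many zeros.
  rcases ht.2.eq_or_lt with h1 | h1
  · refine hc (h.eq_zero_of_not_countable ht (Z := (fun x => x * (-t)) '' Ioo (0 : ℝ) (1 / 2))
      ?_ ?_ ?_)
    · refine fun hcount => hunc (countable_of_injective_of_countable_image (fun x _ y _ hxy => ?_)
        hcount)
      simpa [h1] using hxy
    · rintro _ ⟨x, hx, rfl⟩
      simp only [h1]
      exact ⟨by linarith [hx.2], by linarith [hx.1]⟩
    · rintro _ ⟨x, hx, rfl⟩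
      have h2 := (hzero x hx).2
      rw [h1, mul_one, ← h1] at h2
      have := hsum (hin x ⟨hx.1.le, by linarith [hx.2]⟩).2
      rwa [h2] at this
  · have h0 : 0 < 1 - t := by linarith
    refine hc (h.eq_zero_of_not_countable ht (Z := (fun x => x * (1 - t)) '' Ioo (0 : ℝ) (1 / 2))
      ?_ ?_ ?_)
    · refine fun hcount => hunc (countable_of_injective_of_countable_image (fun x _ y _ hxy => ?_)
        hcount)
      simpa [h0.ne'] using hxy
    · rintro _ ⟨x, hx, rfl⟩
      exact ⟨by nlinarith [hx.1, ht.1], by nlinarith [hx.2]⟩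
    · rintro _ ⟨x, hx, rfl⟩
      have h2 := (mul_eq_zero.1 (hzero x hx).1).resolve_right h0.ne'
      have := hsum (hin x ⟨hx.1.le, by linarith [hx.2]⟩).1
      rwa [h2] at this

end RealPowerSeries

/-! ## Simple functions -/

section

theorem BInterval.Ioo_subset (I : BInterval) : Ioo I.lo I.hi ⊆ I.carrier := by
  rcases I.isInterval with h | h | h | h <;> rw [h]
  exacts [Ioo_subset_Ico_self, Ioo_subset_Ioc_self, Ioo_subset_Icc_self]

theorem BInterval.subset_Icc (I : BInterval) : I.carrier ⊆ Icc I.lo I.hi := by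
  rcases I.isInterval with h | h | h | h <;> rw [h]
  exacts [Ioo_subset_Icc_self, Ico_subset_Icc_self, Ioc_subset_Icc_self]

theorem BInterval.length_nonneg (I : BInterval) : 0 ≤ I.length := sub_nonneg.2 I.lo_le_hi

theorem BInterval.length_pos {I : BInterval} (hI : I.lo < I.hi) : 0 < I.length := sub_pos.2 hI

/-- The position in an interval, rescaled to `[0, 1]`, of a point of the closed interval. -/
def relPos (I : BInterval) (x : LC) : LC := (x - I.lo) / I.length

/-- The coefficients of a power series in the variable rescaled by the length of the interval. -/
def scaledCoeff (I : BInterval) (a : ℕ → LC) (n : ℕ) : LC := a n * I.length ^ n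

variable {I : BInterval} {g : LC → LC} {x₀ : LC} {a : ℕ → LC}

theorem relPos_mem (hI : I.lo < I.hi) {x : LC} (hx : x ∈ Icc I.lo I.hi) :
    relPos I x ∈ Icc (ofReal 0) (ofReal 1) := by
  have h := BInterval.length_pos hI
  rw [ofReal_zero, ofReal_one]
  refine ⟨div_nonneg (sub_nonneg.2 hx.1) h.le, (div_le_one h).2 ?_⟩
  unfold BInterval.length
  linarith [hx.2]

theorem relPos_coeff_mem (hI : I.lo < I.hi) {x : LC} (hx : x ∈ Icc I.lo I.hi) :
    coeff (relPos I x) 0 ∈ Icc (0 : ℝ) 1 := coeff_mem_Icc (relPos_mem hI hx)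

/-- The centre is infinitely close, relative to the length, to its real position; the strict real
inequalities absorb this infinitesimal discrepancy. -/
theorem add_mul_mem_Ioo (hI : I.lo < I.hi) (hx : x₀ ∈ Icc I.lo I.hi) {s : ℝ}
    (hs : s ∈ Ioo (-coeff (relPos I x₀) 0) (1 - coeff (relPos I x₀) 0)) :
    x₀ + I.length * ofReal s ∈ Ioo I.lo I.hi := by
  have h := BInterval.length_pos hI
  have hm := orderGE_of_mem_Icc (relPos_mem hI hx)
  have hx0 : x₀ = I.lo + I.length * relPos I x₀ := by
    unfold relPos; field_simp; ring
  have h1 : ofReal (-s) < relPos I x₀ := ofReal_lt_of_lt_coeff hm (by linarith [hs.1])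
  have h2 : relPos I x₀ < ofReal (1 - s) := lt_ofReal_of_coeff_lt hm (by linarith [hs.2])
  rw [ofReal_neg] at h1
  rw [ofReal_sub, ofReal_one] at h2
  have h3 := mul_pos h (by linarith : 0 < relPos I x₀ + ofReal s)
  have h4 := mul_pos h (by linarith : 0 < 1 - (relPos I x₀ + ofReal s))
  have h5 : I.length = I.hi - I.lo := rfl
  constructor
  · linear_combination (exp := 1) h3 - hx0
  · linear_combination (exp := 1) h4 + hx0 + h5

/-- This is the bridge to real analysis: weak convergence implies convergence of each coefficient,
and at real values of the rescaled variable every exponent `q` carries an ordinary real power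
series. -/
theorem IsPowerSeriesOn.tendsto_coeff (h : IsPowerSeriesOn g I x₀ a) (hI : I.lo < I.hi) {s : ℝ}
    (hs : s ∈ Ioo (-coeff (relPos I x₀) 0) (1 - coeff (relPos I x₀) 0)) (q : ℚ) :
    Tendsto (fun m => ∑ n ∈ Finset.range m, coeff (scaledCoeff I a n) q * s ^ n) atTop
      (𝓝 (coeff (g (x₀ + I.length * ofReal s)) q)) := by
  refine ((h.2 _ (I.Ioo_subset (add_mul_mem_Ioo hI h.1 hs))).tendsto_coeff q).congr fun m => ?_
  refine Finset.sum_congr rfl fun n _ => ?_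
  rw [mul_comm _ (s ^ n), ← coeff_ofReal_mul]
  congr 1
  unfold scaledCoeff
  rw [ofReal_pow]
  ring

theorem IsPowerSeriesOn.convergesOn (h : IsPowerSeriesOn g I x₀ a) (hI : I.lo < I.hi) (q : ℚ) :
    ConvergesOn (fun n => coeff (scaledCoeff I a n) q) (coeff (relPos I x₀) 0) :=
  fun _ hs => ⟨_, h.tendsto_coeff hI hs q⟩

theorem not_countable_unit_Ioo (t : ℝ) : ¬ (Ioo (-t) (1 - t)).Countable := by
  rw [Cardinal.Real.Ioo_countable_iff]
  linarith

/-- A nonzero power series which converges weakly on an interval has, after rescaling, a smallest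
exponent. -/
theorem IsPowerSeriesOn.exists_min (h : IsPowerSeriesOn g I x₀ a) (hI : I.lo < I.hi) {n₁ : ℕ}
    (hn : scaledCoeff I a n₁ ≠ 0) : ∃ q, (∀ n, OrderGE q (scaledCoeff I a n)) ∧
      (fun n => coeff (scaledCoeff I a n) q) ≠ 0 := by
  have ht := relPos_coeff_mem hI h.1
  obtain ⟨q₁, -, hq₁⟩ := exists_orderGE hn
  set U : Set ℚ := {q | (fun n => coeff (scaledCoeff I a n) q) ≠ 0 ∧ q ≤ q₁} with hU
  have hq₁U : q₁ ∈ U := ⟨fun h0 => hq₁ (congrFun h0 n₁), le_rfl⟩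
  -- Each exponent in `U` has a nonzero real series with countably many zeros, and `U` is countable.
  -- So some real `s` avoids all the zeros, and there all of `U` lies in the left-finite support of
  -- one value of `g`.
  have hfin : U.Finite := by
    set J := Ioo (-coeff (relPos I x₀) 0) (1 - coeff (relPos I x₀) 0) with hJ
    set Z : ℚ → Set ℝ := fun q => {s | s ∈ J ∧ coeff (g (x₀ + I.length * ofReal s)) q = 0}
    have hZ : (⋃ q ∈ U, Z q).Countable := by
      refine (Set.to_countable U).biUnion fun q hq => ?_
      by_contra hcount
      refine hq.1 ((h.convergesOn hI q).eq_zero_of_not_countable ht hcount (fun s hs => hs.1) ?_)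
      intro s hs
      have := h.tendsto_coeff hI hs.1 q
      rwa [hs.2] at this
    obtain ⟨s, hs, hsZ⟩ : ∃ s ∈ J, s ∉ ⋃ q ∈ U, Z q := by
      by_contra! hall
      exact not_countable_unit_Ioo _ (hZ.mono hall)
    refine (leftFinite_coeff (g (x₀ + I.length * ofReal s)) q₁).subset fun q hq => ⟨?_, hq.2⟩
    intro h0
    exact hsZ (mem_biUnion hq ⟨hs, h0⟩)
  obtain ⟨q, hq, hmin⟩ := Set.exists_min_image U id hfin ⟨q₁, hq₁U⟩
  refine ⟨q, fun n p hp => ?_, hq.1⟩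
  by_contra h0
  have hle := hmin p ⟨fun h1 => h0 (congrFun h1 n), hp.le.trans hq.2⟩
  exact absurd hle (not_le.2 hp)

/-- A simple function with countably many values is constant. -/
theorem IsSimpleOn.exists_eq_const (h : IsSimpleOn g I) (hI : I.lo < I.hi)
    (hc : (g '' I.carrier).Countable) : ∃ κ, ∀ x ∈ I.carrier, g x = κ := by
  obtain ⟨x₀, a, h⟩ := h
  have ht := relPos_coeff_mem hI h.1
  set J := Ioo (-coeff (relPos I x₀) 0) (1 - coeff (relPos I x₀) 0) with hJ
  -- Uncountably many real positions and countably many values: some value is taken uncountably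
  -- often, and subtracting it leaves series with uncountably many zeros.
  obtain ⟨κ, hκ⟩ : ∃ κ, ¬ {s | s ∈ J ∧ g (x₀ + I.length * ofReal s) = κ}.Countable := by
    by_contra! hall
    refine not_countable_unit_Ioo (coeff (relPos I x₀) 0)
      (Countable.mono (fun s hs => ?_) (hc.biUnion fun κ _ => hall κ))
    exact mem_biUnion ⟨_, I.Ioo_subset (add_mul_mem_Ioo hI h.1 hs), rfl⟩ ⟨hs, rfl⟩
  have key : ∀ q, (fun n => coeff (scaledCoeff I a n) q - if n = 0 then coeff κ q else 0) = 0 := by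
    intro q
    have hconv : ∀ s ∈ J, Tendsto (fun m => ∑ n ∈ Finset.range m,
        (coeff (scaledCoeff I a n) q - if n = 0 then coeff κ q else 0) * s ^ n) atTop
        (𝓝 (coeff (g (x₀ + I.length * ofReal s)) q - coeff κ q)) := by
      intro s hs
      refine ((h.tendsto_coeff hI hs q).sub (tendsto_const_nhds (x := coeff κ q))).congr' ?_
      filter_upwards [eventually_ge_atTop 1] with m hm
      simp only [sub_mul, Finset.sum_sub_distrib, ite_mul, zero_mul]
      rw [Finset.sum_ite_eq' (Finset.range m) 0, if_pos (Finset.mem_range.2 hm), pow_zero, mul_one]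
    refine ConvergesOn.eq_zero_of_not_countable (fun s hs => ⟨_, hconv s hs⟩) ht hκ
      (fun s hs => hs.1) fun s hs => ?_
    have := hconv s hs.1
    rwa [hs.2, sub_self] at this
  have hb : ∀ n ≥ 1, a n = 0 := by
    intro n hn
    have h0 : scaledCoeff I a n = 0 := ext_coeff fun q => by
      have := congrFun (key q) n
      simpa [Nat.one_le_iff_ne_zero.1 hn] using this
    exact (mul_eq_zero.1 h0).resolve_right (pow_ne_zero _ (BInterval.length_pos hI).ne')
  refine ⟨a 0, fun x hx => ?_⟩
  have h1 := hasWeakSum_of_forall_ge (c := fun n => a n * (x - x₀) ^ n) (N := 1)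
    fun n hn => by rw [hb n hn, zero_mul]
  have := (h.2 x hx).unique h1
  simpa using this

/-- Let `q` be the least exponent of the rescaled series and `r` that of the length, which enters
once more through integration. The coefficient of `F y - F x` at `r + q` is then a positive multiple
of a real integral over the whole unit interval, since `x` and `y` are infinitely close to the ends
on the scale of the length. -/
theorem IsPowerSeriesOn.antideriv_le_of_relPos (h : IsPowerSeriesOn g I x₀ a) (hI : I.lo < I.hi)
    (hg : ∀ x ∈ I.carrier, 0 ≤ g x) {F : LC → LC}
    (hF : ∀ x ∈ I.carrier, HasWeakSum (fun n => a n / ((n : LC) + 1) * (x - x₀) ^ (n + 1)) (F x))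
    {x y : LC} (hx : x ∈ I.carrier) (hy : y ∈ I.carrier) (hx0 : coeff (relPos I x) 0 = 0)
    (hy1 : coeff (relPos I y) 0 = 1) : F x ≤ F y := by
  by_cases hall : ∀ n, scaledCoeff I a n = 0
  · have ha : ∀ n, a n = 0 := fun n =>
      (mul_eq_zero.1 (hall n)).resolve_right (pow_ne_zero _ (BInterval.length_pos hI).ne')
    have hF0 : ∀ z ∈ I.carrier, F z = 0 := fun z hz => by
      have := hasWeakSum_of_forall_ge (c := fun n => a n / ((n : LC) + 1) * (z - x₀) ^ (n + 1))
        (N := 0) fun n _ => by simp [ha n]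
      simpa using (hF z hz).unique this
    rw [hF0 x hx, hF0 y hy]
  push Not at hall
  obtain ⟨n₁, hn₁⟩ := hall
  obtain ⟨q, hq, hq0⟩ := h.exists_min hI hn₁
  obtain ⟨r, hr, hr0⟩ := exists_orderGE_pos (BInterval.length_pos hI)
  have ht := relPos_coeff_mem hI h.1
  have hterm : ∀ z ∈ I.carrier, OrderGE (r + q) (F z) ∧
      Tendsto (fun m => ∑ n ∈ Finset.range m, coeff (scaledCoeff I a n) q / (n + 1) *
        (coeff (relPos I z) 0 - coeff (relPos I x₀) 0) ^ (n + 1)) atTop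
        (𝓝 (coeff (F z) (r + q) / coeff I.length r)) := by
    intro z hz
    have hσ : OrderGE 0 (relPos I z - relPos I x₀) :=
      (orderGE_of_mem_Icc (relPos_mem hI (I.subset_Icc hz))).sub
        (orderGE_of_mem_Icc (relPos_mem hI h.1))
    have heq : ∀ n : ℕ, a n / ((n : LC) + 1) * (z - x₀) ^ (n + 1) =
        I.length * (scaledCoeff I a n * (ofReal (1 / (n + 1)) *
          (relPos I z - relPos I x₀) ^ (n + 1))) := by
      intro n
      have hne := (BInterval.length_pos hI).ne'
      have hz : z - x₀ = I.length * (relPos I z - relPos I x₀) := by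
        unfold relPos; field_simp; ring
      have hn : ofReal (1 / ((n : ℝ) + 1)) = 1 / ((n : LC) + 1) := by
        rw [ofReal_div, ofReal_add, ofReal_natCast, ofReal_one]
      rw [hz, hn, mul_pow]
      unfold scaledCoeff
      ring
    have hpow : ∀ n : ℕ, OrderGE 0 (ofReal (1 / ((n : ℝ) + 1)) *
        (relPos I z - relPos I x₀) ^ (n + 1)) := fun n => by
      simpa using (orderGE_ofReal _).mul (hσ.pow (n + 1))
    have hin : ∀ n : ℕ, OrderGE q (scaledCoeff I a n * (ofReal (1 / ((n : ℝ) + 1)) *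
        (relPos I z - relPos I x₀) ^ (n + 1))) := fun n => by
      simpa using (hq n).mul (hpow n)
    constructor
    · intro p hp
      refine tendsto_nhds_unique ((hF z hz).tendsto_coeff p) ?_
      refine tendsto_const_nhds.congr fun m => (Finset.sum_eq_zero fun n _ => ?_).symm
      rw [heq n]
      exact (hr.mul (hin n)) p hp
    · refine (((hF z hz).tendsto_coeff (r + q)).div_const (coeff I.length r)).congr fun m => ?_
      rw [Finset.sum_div]
      refine Finset.sum_congr rfl fun n _ => ?_
      have h1 := coeff_mul_of_orderGE (hq n) (hpow n)
      rw [add_zero, coeff_ofReal_mul, coeff_pow_zero hσ, coeff_sub] at h1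
      rw [heq n, coeff_mul_of_orderGE hr (hin n), h1]
      field_simp
  obtain ⟨hx1, hx2⟩ := hterm x hx
  obtain ⟨hy1', hy2⟩ := hterm y hy
  rw [hx0, zero_sub] at hx2
  rw [hy1] at hy2
  -- Nonnegativity of the real series holds because its sum is the coefficient of `g` at an exponent
  -- below which `g` vanishes at that point.
  have hlt := (h.convergesOn hI q).antideriv_lt ht hq0 (fun s hs l hl => ?_) hx2 hy2
  · rw [div_lt_div_iff_of_pos_right hr0] at hlt
    have := pos_of_coeff_pos (hy1'.sub hx1) (by rw [coeff_sub]; linarith)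
    exact (sub_pos.1 this).le
  · have hgs := hg _ (I.Ioo_subset (add_mul_mem_Ioo hI h.1 hs))
    have hcoeff := h.tendsto_coeff hI hs
    rw [tendsto_nhds_unique hl (hcoeff q)]
    refine coeff_nonneg (fun p hp => ?_) hgs
    refine tendsto_nhds_unique (hcoeff p) (tendsto_const_nhds.congr fun m =>
      (Finset.sum_eq_zero fun n _ => ?_).symm)
    rw [hq n p hp, zero_mul]

/-- Provides points close enough to an end for the limit there, and also infinitely close on the
scale of the interval's length, even when that length is itself infinitesimal. -/
theorem exists_small (hI : I.lo < I.hi) {δ : LC} (hδ : 0 < δ) : ∃ η, 0 < η ∧ η < δ ∧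
    η < I.length ∧ coeff (η / I.length) 0 = 0 := by
  have h := BInterval.length_pos hI
  have hm : monomial 1 < 1 := by
    simpa using lt_ofReal_of_coeff_lt (r := 1) ((orderGE_monomial 1).mono zero_le_one)
      (by simp [coeff_monomial])
  refine ⟨min (δ / 2) (I.length * monomial 1), lt_min (half_pos hδ) (mul_pos h (monomial_pos 1)),
    (min_le_left _ _).trans_lt (half_lt_self hδ), (min_le_right _ _).trans_lt ?_, ?_⟩
  · exact mul_lt_of_lt_one_right h hm
  · refine ((orderGE_monomial 1).of_abs_le ?_) 0 zero_lt_one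
    rw [abs_of_nonneg (div_nonneg (le_min (half_pos hδ).le (mul_pos h (monomial_pos 1)).le) h.le),
      div_le_iff₀ h, mul_comm (monomial 1)]
    exact min_le_right _ _

/-- Nonnegative simple functions have nonnegative integrals. -/
theorem IsPowerSeriesOn.antideriv_le (h : IsPowerSeriesOn g I x₀ a) (hI : I.lo < I.hi)
    (hg : ∀ x ∈ I.carrier, 0 ≤ g x) {F : LC → LC} {u w : LC}
    (hF : ∀ x ∈ I.carrier, HasWeakSum (fun n => a n / ((n : LC) + 1) * (x - x₀) ^ (n + 1)) (F x))
    (hu : TendstoWithin F I.carrier I.lo u) (hw : TendstoWithin F I.carrier I.hi w) : u ≤ w := by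
  have hlen := BInterval.length_pos hI
  have hldef : I.length = I.hi - I.lo := rfl
  refine le_of_forall_pos_le_add fun ε hε => ?_
  obtain ⟨δ, hδ, hu'⟩ := hu (ε / 2) (half_pos hε)
  obtain ⟨δ', hδ', hw'⟩ := hw (ε / 2) (half_pos hε)
  obtain ⟨η, h0, h1, h2, h3⟩ := exists_small hI hδ
  obtain ⟨η', h0', h1', h2', h3'⟩ := exists_small hI hδ'
  have hx : I.lo + η ∈ I.carrier := I.Ioo_subset ⟨by linarith, by linarith⟩
  have hy : I.hi - η' ∈ I.carrier := I.Ioo_subset ⟨by linarith, by linarith⟩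
  have e1 : |I.lo + η - I.lo| = η := by rw [add_sub_cancel_left, abs_of_pos h0]
  have e2 : |I.hi - η' - I.hi| = η' := by
    rw [show I.hi - η' - I.hi = -η' by ring, abs_neg, abs_of_pos h0']
  have k1 := hu' _ hx (by rwa [e1]) (by rwa [e1])
  have k2 := hw' _ hy (by rwa [e2]) (by rwa [e2])
  have k3 := h.antideriv_le_of_relPos hI hg hF hx hy ?_ ?_
  · rw [abs_lt] at k1 k2
    linarith [k1.1, k2.2]
  · rwa [relPos, add_sub_cancel_left]
  · rw [relPos, show I.hi - η' - I.lo = I.length - η' by rw [hldef]; ring, sub_div,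
      div_self hlen.ne', coeff_sub, h3', sub_zero]
    simpa using coeff_ofReal_zero 1

end

/-! ## Measure of intervals -/

theorem StrongLim.const_mul {s : ℕ → LC} {l : LC} (hs : StrongLim s l) (C : LC) :
    StrongLim (fun n => C * s n) (C * l) := by
  intro ε hε
  have hC : 0 < |C| + 1 := by positivity
  obtain ⟨N, hN⟩ := hs (ε / (|C| + 1)) (div_pos hε hC)
  refine ⟨N, fun m hm => ?_⟩
  rw [← mul_sub, abs_mul]
  have h1 := (lt_div_iff₀ hC).1 (hN m hm)
  nlinarith [abs_nonneg (s m - l), abs_nonneg C]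

theorem HasStrongSum.add_const_mul {c d : ℕ → LC} {l k : LC} (hc : HasStrongSum c l)
    (hd : HasStrongSum d k) (C : LC) : HasStrongSum (fun n => c n + C * d n) (l + C * k) := by
  unfold HasStrongSum
  simpa only [Finset.sum_add_distrib, Finset.mul_sum] using
    StrongLim.add hc (StrongLim.const_mul hd C)

theorem HasStrongSum.le_of_forall_le {c : ℕ → LC} {l k : LC} (hc : HasStrongSum c l)
    (h : ∀ N, ∑ n ∈ Finset.range N, c n ≤ k) : l ≤ k := StrongLim.le_of_forall_le hc h

theorem BInterval.mem_Icc_of_subset {J : BInterval} {α β : LC} (hJ : J.lo < J.hi)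
    (h : J.carrier ⊆ Icc α β) : α ≤ J.lo ∧ J.hi ≤ β := by
  constructor
  · by_contra hlt
    obtain ⟨x, hx, hx'⟩ := exists_between (lt_min hJ (not_le.1 hlt))
    exact absurd (h (J.Ioo_subset ⟨hx, hx'.trans_le (min_le_left _ _)⟩)).1
      (not_le.2 (hx'.trans_le (min_le_right _ _)))
  · by_contra hlt
    obtain ⟨x, hx, hx'⟩ := exists_between (max_lt hJ (not_le.1 hlt))
    exact absurd (h (J.Ioo_subset ⟨(le_max_left _ _).trans_lt hx, hx'⟩)).2
      (not_le.2 ((le_max_right _ _).trans_lt hx))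

/-- The increments of a monotone function over disjoint subintervals of `[α, β]` add up to at most
its increment over `[α, β]`. -/
theorem sum_increment_le {φ : LC → LC} {α β : LC} (hαβ : α ≤ β) (hφ : MonotoneOn φ (Icc α β))
    {J : ℕ → BInterval} (hd : MutuallyDisjoint J) (hJ : ⋃ n, (J n).carrier ⊆ Icc α β)
    (s : Finset ℕ) : ∑ n ∈ s, (φ (J n).hi - φ (J n).lo) ≤ φ β - φ α := by
  have hsub : ∀ n, (J n).lo < (J n).hi → α ≤ (J n).lo ∧ (J n).hi ≤ β := fun n hn =>
    BInterval.mem_Icc_of_subset hn ((subset_iUnion (fun n => (J n).carrier) n).trans hJ)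
  -- Induction on the interval with the largest right end: by disjointness the others end before its
  -- left end, which becomes the new `γ`.
  have key : ∀ s : Finset ℕ, (∀ n ∈ s, (J n).lo < (J n).hi) → ∀ γ ∈ Icc α β,
      (∀ n ∈ s, (J n).hi ≤ γ) → ∑ n ∈ s, (φ (J n).hi - φ (J n).lo) ≤ φ γ - φ α := by
    intro s
    induction s using Finset.induction_on_max_value (fun n => (J n).hi) with
    | empty =>
      intro _ γ hγ _
      simpa using hφ ⟨le_rfl, hαβ⟩ hγ hγ.1
    | insert k s hk hmax ih =>
      intro hlt γ hγ hle
      have hk1 := hlt k (Finset.mem_insert_self _ _)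
      obtain ⟨h1, h2⟩ := hsub k hk1
      have hmem : (J k).lo ∈ Icc α β := ⟨h1, hk1.le.trans h2⟩
      have h3 := ih (fun n hn => hlt n (Finset.mem_insert_of_mem hn)) _ hmem fun n hn => by
        by_contra hcon
        have hn1 := hlt n (Finset.mem_insert_of_mem hn)
        obtain ⟨x, hx, hx'⟩ := exists_between (max_lt hn1 (not_le.1 hcon))
        have hne : n ≠ k := fun h => hk (h ▸ hn)
        exact Set.disjoint_left.1 (hd hne)
          ((J n).Ioo_subset ⟨(le_max_left _ _).trans_lt hx, hx'⟩)
          ((J k).Ioo_subset ⟨(le_max_right _ _).trans_lt hx, hx'.trans_le (hmax n hn)⟩)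
      rw [Finset.sum_insert hk]
      have h4 := hφ ⟨h1.trans hk1.le, h2⟩ hγ (hle k (Finset.mem_insert_self _ _))
      linarith
  -- Intervals with equal end points contribute zero and are set aside, since an empty one may have
  -- its end points anywhere.
  rw [← Finset.sum_filter_add_sum_filter_not s fun n => (J n).lo < (J n).hi,
    Finset.sum_eq_zero (s := s.filter fun n => ¬ (J n).lo < (J n).hi), add_zero]
  · exact key _ (fun n hn => (Finset.mem_filter.1 hn).2) β ⟨hαβ, le_rfl⟩
      fun n hn => (hsub n (Finset.mem_filter.1 hn).2).2
  · intro n hn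
    rw [le_antisymm (J n).lo_le_hi (not_lt.1 (Finset.mem_filter.1 hn).2), sub_self]

/-- Comparison of the increments of a Lipschitz function over disjoint subintervals of `[α, β]`
with its increment over `[α, β]`. -/
theorem sum_le_of_lipschitz {Φ : LC → LC} {α β C w L : LC} (hαβ : α ≤ β)
    (hΦ : ∀ x ∈ Icc α β, ∀ y ∈ Icc α β, |Φ x - Φ y| ≤ C * |x - y|)
    {J : ℕ → BInterval} (hd : MutuallyDisjoint J) (hJ : ⋃ n, (J n).carrier ⊆ Icc α β)
    {c : ℕ → LC} (hc : ∀ n, c n ≤ Φ (J n).hi - Φ (J n).lo) (hw : HasStrongSum c w)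
    (hL : HasStrongSum (fun n => (J n).length) L) : w ≤ Φ β - Φ α + C * (β - α - L) := by
  -- Adding `C * x` makes `Φ` monotone; the correction left at the end is `C` times the length not
  -- covered.
  have hmono : MonotoneOn (fun x => Φ x + C * x) (Icc α β) := by
    intro x hx y hy hxy
    have h1 := hΦ y hy x hx
    rw [abs_of_nonneg (sub_nonneg.2 hxy)] at h1
    have h2 := (abs_le.1 h1).1
    change Φ x + C * x ≤ Φ y + C * y
    linarith
  have := (hw.add_const_mul hL C).le_of_forall_le (k := Φ β - Φ α + C * (β - α)) fun N => by
    have h1 := sum_increment_le hαβ hmono hd hJ (Finset.range N)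
    have h2 : ∑ n ∈ Finset.range N, (c n + C * (J n).length) ≤
        ∑ n ∈ Finset.range N, (Φ (J n).hi + C * (J n).hi - (Φ (J n).lo + C * (J n).lo)) := by
      refine Finset.sum_le_sum fun n _ => ?_
      have := hc n
      unfold BInterval.length
      linarith
    linarith
  linarith

/-- The empty interval. -/
def emptyInterval : BInterval := ⟨0, 0, le_rfl, Ioo 0 0, Or.inl rfl⟩

theorem emptyInterval_carrier : emptyInterval.carrier = ∅ := Ioo_self 0

theorem emptyInterval_length : emptyInterval.length = 0 := sub_self 0

/-- The closed interval `[α, β]`. -/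
def closedInterval {α β : LC} (h : α ≤ β) : BInterval :=
  ⟨α, β, h, Icc α β, Or.inr (Or.inr (Or.inr rfl))⟩

/-- The sequence of intervals whose only nonempty member is `K`. -/
def singleInterval (K : BInterval) (n : ℕ) : BInterval := if n = 0 then K else emptyInterval

theorem singleInterval_disjoint (K : BInterval) : MutuallyDisjoint (singleInterval K) := by
  intro m n hmn
  rcases Nat.eq_zero_or_pos m with rfl | hm
  · simp [singleInterval, hmn.symm, emptyInterval_carrier]
  · simp [singleInterval, hm.ne', emptyInterval_carrier]

theorem iUnion_singleInterval (K : BInterval) :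
    ⋃ n, (singleInterval K n).carrier = K.carrier := by
  apply subset_antisymm
  · refine iUnion_subset fun n => ?_
    unfold singleInterval
    split_ifs
    · exact subset_rfl
    · simp [emptyInterval_carrier]
  · exact subset_iUnion (fun n => (singleInterval K n).carrier) 0

theorem hasStrongSum_singleInterval (K : BInterval) :
    HasStrongSum (fun n => (singleInterval K n).length) K.length := by
  have := hasStrongSum_of_forall_ge (c := fun n => (singleInterval K n).length) (N := 1)
    fun n hn => by simp [singleInterval, Nat.one_le_iff_ne_zero.1 hn, emptyInterval_length]
  simpa [singleInterval] using this

/-- The projection to an interval. -/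
def clamp (J : BInterval) (x : LC) : LC := max J.lo (min x J.hi)

theorem clamp_mono (J : BInterval) : Monotone (clamp J) := fun _ _ h =>
  max_le_max_left _ (min_le_min_right _ h)

/-- Both sides measure the overlap of `[a, b]` and `[l, h]`, by clamping the ends of either interval
into the other. -/
theorem clamp_aux {K : Type*} [AddCommGroup K] [LinearOrder K] [IsOrderedAddMonoid K]
    {a b l h : K} (hab : a ≤ b) (hlh : l ≤ h) :
    max a (min b h) - max a (min b l) ≤ max l (min b h) - max l (min a h) := by
  rcases le_total b h with h1 | h1 <;> rcases le_total b l with h2 | h2 <;>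
  rcases le_total a h with h3 | h3 <;> rcases le_total a l with h4 | h4 <;>
  simp [*] <;> grind

/-- An interval not filled by finitely many intervals contains a large gap. -/
theorem exists_gap (J : ℕ → BInterval) (s : Finset ℕ) : ∀ {α β η : LC}, α ≤ β → 0 < η →
    ∑ n ∈ s, (clamp (J n) β - clamp (J n) α) + η ≤ β - α →
    ∃ c d, α ≤ c ∧ d ≤ β ∧ η ≤ 2 ^ s.card * (d - c) ∧
      ∀ n ∈ s, Disjoint (Ioo c d) (J n).carrier := by
  induction s using Finset.induction_on with
  | empty =>
    intro α β η _ _ h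
    exact ⟨α, β, le_rfl, le_rfl, by simpa using h, by simp⟩
  | insert k s hk ih =>
    intro α β η hαβ hη h
    rw [Finset.sum_insert hk] at h
    set γ := max α (min β (J k).lo) with hγ
    set δ := max α (min β (J k).hi) with hδ
    have hγδ : γ ≤ δ := max_le_max_left _ (min_le_min_left _ (J k).lo_le_hi)
    have hαγ : α ≤ γ := le_max_left _ _
    have hδβ : δ ≤ β := max_le hαβ (min_le_left _ _)
    have hmid : δ - γ ≤ clamp (J k) β - clamp (J k) α := by
      exact clamp_aux hαβ (J k).lo_le_hi
    -- Removing the interval `J k` leaves `[α, γ]` and `[δ, β]`; one of them keeps half of the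
    -- excess `η`, which accounts for one factor `2` per interval.
    have hsplit : (∑ n ∈ s, (clamp (J n) γ - clamp (J n) α) + η / 2 ≤ γ - α) ∨
        (∑ n ∈ s, (clamp (J n) β - clamp (J n) δ) + η / 2 ≤ β - δ) := by
      by_contra! hcon
      have h1 : ∑ n ∈ s, (clamp (J n) γ - clamp (J n) α) +
          ∑ n ∈ s, (clamp (J n) β - clamp (J n) δ) ≤
          ∑ n ∈ s, (clamp (J n) β - clamp (J n) α) := by
        rw [← Finset.sum_add_distrib]
        refine Finset.sum_le_sum fun n _ => ?_
        linarith [clamp_mono (J n) hγδ]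
      linarith [hcon.1, hcon.2]
    have hcard : ((2 : LC) ^ (insert k s).card) = 2 ^ s.card * 2 := by
      rw [Finset.card_insert_of_notMem hk, pow_succ]
    rcases hsplit with h1 | h1
    · obtain ⟨c, d, hc, hd, hcd, hdis⟩ := ih hαγ (half_pos hη) h1
      refine ⟨c, d, hc, hd.trans (hγδ.trans hδβ), by rw [hcard]; linarith, fun n hn => ?_⟩
      rcases Finset.mem_insert.1 hn with rfl | hn
      · rw [Set.disjoint_left]
        intro x hx hxJ
        rcases lt_max_iff.1 (hx.2.trans_le hd) with h2 | h2
        · exact absurd hx.1 (not_lt.2 (h2.le.trans hc))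
        · exact absurd (h2.trans_le (min_le_right _ _)) (not_lt.2 ((J n).subset_Icc hxJ).1)
      · exact hdis n hn
    · obtain ⟨c, d, hc, hd, hcd, hdis⟩ := ih hδβ (half_pos hη) h1
      refine ⟨c, d, hαγ.trans (hγδ.trans hc), hd, by rw [hcard]; linarith, fun n hn => ?_⟩
      rcases Finset.mem_insert.1 hn with rfl | hn
      · rw [Set.disjoint_left]
        intro x hx hxJ
        rcases min_lt_iff.1 (((le_max_right _ _).trans hc).trans_lt hx.1) with h2 | h2
        · exact absurd (hx.2.trans_le hd) (not_lt.2 h2.le)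
        · exact absurd h2 (not_lt.2 ((J n).subset_Icc hxJ).2)
      · exact hdis n hn

/-- If the lengths sum to less than `β - α`, by a deficit `η`, then all but `N` intervals are
shorter than `η` times an infinitesimal, while the first `N` leave a gap of length at least `η / 2 ^
N`. Points dividing the gap in distinct real ratios are too far apart to share a late interval, so
an uncountable set would inject into `ℕ`. -/
theorem length_le_of_cover {α β : LC} {J : ℕ → BInterval} {M : LC}
    (hJ : Icc α β ⊆ ⋃ n, (J n).carrier) (hM : HasStrongSum (fun n => (J n).length) M)
    (hαβ : α ≤ β) : β - α ≤ M := by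
  by_contra hlt
  set η := β - α - M with hη
  have hη0 : 0 < η := by linarith [not_le.1 hlt]
  obtain ⟨N, hN⟩ := hM.exists_abs_lt (mul_pos hη0 (monomial_pos 1))
  obtain ⟨c, d, hc, hd, hcd, hdis⟩ := exists_gap J (Finset.range N) hαβ hη0 (by
    have h1 := hM.sum_le (fun n => (J n).length_nonneg) (Finset.range N)
    have h2 : ∑ n ∈ Finset.range N, (clamp (J n) β - clamp (J n) α) ≤
        ∑ n ∈ Finset.range N, (J n).length := by
      refine Finset.sum_le_sum fun n _ => ?_
      have h3 : clamp (J n) β ≤ (J n).hi := max_le (J n).lo_le_hi (min_le_right _ _)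
      have h4 : (J n).lo ≤ clamp (J n) α := le_max_left _ _
      unfold BInterval.length
      linarith
    linarith)
  rw [Finset.card_range] at hcd
  have h2N : (0 : LC) < 2 ^ N := by positivity
  have hcd0 : 0 < d - c := by
    by_contra hle
    have := mul_nonneg h2N.le (neg_nonneg.2 (not_lt.1 hle))
    linarith
  have hmem : ∀ r ∈ Ioo (0 : ℝ) 1, c + (d - c) * ofReal r ∈ Ioo c d := by
    intro r hr
    have h1 := mul_pos hcd0 (ofReal_pos hr.1)
    have h2 := mul_lt_mul_of_pos_left (ofReal_lt.2 hr.2) hcd0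
    rw [ofReal_one] at h2
    exact ⟨by linarith, by linarith⟩
  have hex : ∀ r ∈ Ioo (0 : ℝ) 1, ∃ n, N ≤ n ∧ c + (d - c) * ofReal r ∈ (J n).carrier := by
    intro r hr
    have h1 := hmem r hr
    obtain ⟨n, hn⟩ := mem_iUnion.1 (hJ ⟨hc.trans h1.1.le, h1.2.le.trans hd⟩)
    refine ⟨n, ?_, hn⟩
    by_contra hlt
    exact Set.disjoint_left.1 (hdis n (Finset.mem_range.2 (not_le.1 hlt))) h1 hn
  choose! ν hν using hex
  have hinj : InjOn ν (Ioo 0 1) := by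
    have key : ∀ r ∈ Ioo (0 : ℝ) 1, ∀ r' ∈ Ioo (0 : ℝ) 1, r < r' → ν r ≠ ν r' := by
      intro r hr r' hr' hlt heq
      obtain ⟨h1, h2⟩ := hν r hr
      have h3 := (hν r' hr').2
      rw [← heq] at h3
      have h4 := ((J _).subset_Icc h2).1
      have h5 := ((J _).subset_Icc h3).2
      have h6 := (abs_lt.1 (hN _ h1)).2
      have h7 : (d - c) * ofReal (r' - r) < η * monomial 1 := by
        rw [ofReal_sub]
        unfold BInterval.length at h6
        linarith
      have h8 : η * monomial 1 ≤ (d - c) * (2 ^ N * monomial 1) := by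
        have := mul_le_mul_of_nonneg_right hcd (monomial_pos 1).le
        linarith
      have h9 := lt_of_mul_lt_mul_left (h7.trans_le h8) hcd0.le
      have h10 : OrderGE 1 ((2 : LC) ^ N * monomial 1) := by
        have : (2 : LC) ^ N = ofReal (2 ^ N) := by
          rw [ofReal_pow]
          exact congrArg (· ^ N) (map_ofNat ofRealHom 2).symm
        rw [this]
        simpa using (orderGE_ofReal (2 ^ N)).mul (orderGE_monomial 1)
      have h11 := coeff_le_coeff (orderGE_ofReal _) (h10.mono zero_le_one) h9.le
      rw [coeff_ofReal_zero, h10 0 zero_lt_one] at h11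
      linarith
    intro r hr r' hr' heq
    by_contra hne
    rcases lt_or_gt_of_ne hne with h | h
    · exact key r hr r' hr' h heq
    · exact key r' hr' r hr h heq.symm
  have hcount : (Ioo (0 : ℝ) 1).Countable :=
    countable_of_injective_of_countable_image hinj (Set.to_countable _)
  rw [Cardinal.Real.Ioo_countable_iff] at hcount
  linarith

theorem length_le_of_subset {α β : LC} {J : ℕ → BInterval} {L : LC} (hd : MutuallyDisjoint J)
    (hJ : ⋃ n, (J n).carrier ⊆ Icc α β) (hL : HasStrongSum (fun n => (J n).length) L)
    (hαβ : α ≤ β) : L ≤ β - α :=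
  hL.le_of_forall_le fun _ => sum_increment_le hαβ (monotone_id.monotoneOn _) hd hJ _

/-- The measure of a closed interval is its length. -/
theorem hasMeasure_Icc {α β : LC} (hαβ : α ≤ β) : HasMeasure (Icc α β) (β - α) := by
  have hU := iUnion_singleInterval (closedInterval hαβ)
  have hd := singleInterval_disjoint (closedInterval hαβ)
  have hs := hasStrongSum_singleInterval (closedInterval hαβ)
  refine ⟨fun ε hε => ⟨_, _, _, _, hd, hd, hU.le, hU.ge, hs, hs, by rw [sub_self]; exact hε.le⟩,
    IsGreatest.isLUB ⟨⟨_, hd, hU.le, hs⟩, ?_⟩, IsLeast.isGLB ⟨⟨_, hd, hU.ge, hs⟩, ?_⟩⟩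
  · rintro L ⟨J, hJd, hJ, hL⟩
    exact length_le_of_subset hJd hJ hL hαβ
  · rintro L ⟨J, -, hJ, hL⟩
    exact length_le_of_cover hJ hL hαβ

theorem HasMeasure.unique {A : Set LC} {m m' : LC} (h : HasMeasure A m) (h' : HasMeasure A m') :
    m = m' := h.2.1.unique h'.2.1

/-! ## Step functions -/

section

section Const

variable {g : LC → LC} {I : BInterval} {κ : LC}

theorem hasWeakSum_const (κ x₀ x : LC) :
    HasWeakSum (fun n => (if n = 0 then κ else 0) * (x - x₀) ^ n) κ := by
  have := hasWeakSum_of_forall_ge (c := fun n => (if n = 0 then κ else 0) * (x - x₀) ^ n) (N := 1)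
    fun n hn => by simp [Nat.one_le_iff_ne_zero.1 hn]
  simpa using this

theorem isPowerSeriesOn_const (h : ∀ x ∈ I.carrier, g x = κ) :
    IsPowerSeriesOn g I I.lo fun n => if n = 0 then κ else 0 :=
  ⟨⟨le_rfl, I.lo_le_hi⟩, fun x hx => (h x hx) ▸ hasWeakSum_const _ _ _⟩

theorem isSimpleOn_const (h : ∀ x ∈ I.carrier, g x = κ) : IsSimpleOn g I :=
  ⟨_, _, isPowerSeriesOn_const h⟩

theorem tendstoWithin_of_lipschitz {F : LC → LC} {S : Set LC} {p l C : LC}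
    (h : ∀ x ∈ S, |F x - l| ≤ C * |x - p|) : TendstoWithin F S p l := by
  intro ε hε
  have hC : 0 < |C| + 1 := by positivity
  refine ⟨ε / (|C| + 1), div_pos hε hC, fun x hx h0 hlt => ?_⟩
  have h1 := (lt_div_iff₀ hC).1 hlt
  have h2 := mul_le_mul_of_nonneg_right (le_abs_self C) h0.le
  have h3 := h x hx
  linarith

theorem hasSimpleIntegral_const (h : ∀ x ∈ I.carrier, g x = κ) (hI : I.lo < I.hi) :
    HasSimpleIntegral g I (κ * (I.hi - I.lo)) := by
  refine ⟨_, _, isPowerSeriesOn_const h, Or.inr ⟨hI, fun x => κ * (x - I.lo), 0,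
    κ * (I.hi - I.lo), fun x _ => ?_, ?_, ?_, by rw [sub_zero]⟩⟩
  · have := hasWeakSum_of_forall_ge (c := fun n => (if n = 0 then κ else 0) / ((n : LC) + 1) *
      (x - I.lo) ^ (n + 1)) (N := 1) fun n hn => by simp [Nat.one_le_iff_ne_zero.1 hn]
    simpa using this
  · exact tendstoWithin_of_lipschitz (C := |κ|) fun x _ => by rw [sub_zero, abs_mul]
  · refine tendstoWithin_of_lipschitz (C := |κ|) fun x _ => ?_
    rw [← mul_sub, sub_sub_sub_cancel_right, abs_mul]

end Const

/-- On each of the open intervals `(τ j, τ (j + 1))`, `j < N`, `g` is constant with value `c j`. -/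
structure IsStep (τ : ℕ → LC) (N : ℕ) (c : ℕ → LC) (g : LC → LC) : Prop where
  mono : Monotone τ
  eq : ∀ j < N, ∀ x ∈ Ioo (τ j) (τ (j + 1)), g x = c j

/-- The antiderivative of a step function. -/
def stepAntideriv (τ : ℕ → LC) (N : ℕ) (c : ℕ → LC) (x : LC) : LC :=
  ∑ j ∈ Finset.range N, c j * (min x (τ (j + 1)) - min x (τ j))

variable {τ : ℕ → LC} {N : ℕ} {c : ℕ → LC} {g : LC → LC}

theorem stepAntideriv_lipschitz (x y : LC) : |stepAntideriv τ N c x - stepAntideriv τ N c y| ≤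
    (∑ j ∈ Finset.range N, |c j| * 2) * |x - y| := by
  unfold stepAntideriv
  rw [← Finset.sum_sub_distrib, Finset.sum_mul]
  refine (Finset.abs_sum_le_sum_abs _ _).trans (Finset.sum_le_sum fun j _ => ?_)
  have hmin : ∀ z : LC, |min x z - min y z| ≤ |x - y| := fun z => by
    simpa using abs_min_sub_min_le_max x z y z
  rw [← mul_sub, abs_mul, mul_assoc]
  refine mul_le_mul_of_nonneg_left ?_ (abs_nonneg _)
  rw [show min x (τ (j + 1)) - min x (τ j) - (min y (τ (j + 1)) - min y (τ j)) =
    (min x (τ (j + 1)) - min y (τ (j + 1))) - (min x (τ j) - min y (τ j)) by ring]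
  linarith [abs_sub (min x (τ (j + 1)) - min y (τ (j + 1))) (min x (τ j) - min y (τ j)),
    hmin (τ (j + 1)), hmin (τ j)]

theorem stepAntideriv_sub (hτ : Monotone τ) :
    stepAntideriv τ N c (τ N) - stepAntideriv τ N c (τ 0) =
      ∑ j ∈ Finset.range N, c j * (τ (j + 1) - τ j) := by
  unfold stepAntideriv
  rw [← Finset.sum_sub_distrib]
  refine Finset.sum_congr rfl fun j hj => ?_
  have hj := Finset.mem_range.1 hj
  rw [min_eq_right (hτ hj), min_eq_right (hτ hj.le), min_eq_left (hτ (Nat.zero_le _)),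
    min_eq_left (hτ (Nat.zero_le _)), sub_self, mul_zero, sub_zero]

theorem sum_min_sub {x : LC} (hx : x ∈ Icc (τ 0) (τ N)) :
    ∑ j ∈ Finset.range N, (min x (τ (j + 1)) - min x (τ j)) = x - τ 0 := by
  rw [Finset.sum_range_sub (fun j => min x (τ j)), min_eq_left hx.2, min_eq_right hx.1]

/-- The difference `min x b - min x a` is the length of the part of `[a, b]` to the left of `x`; it
does not change across an interval that has no interior in common with `[a, b]`. -/
theorem min_sub_min_eq {K : Type*} [AddCommGroup K] [LinearOrder K] [IsOrderedAddMonoid K]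
    {l h a b : K} (hlh : l ≤ h) (hab : a ≤ b) (hle : min h b ≤ max l a) :
    min h b - min h a = min l b - min l a := by
  rcases le_total h b with h1 | h1 <;> rcases le_total h a with h2 | h2 <;>
  rcases le_total l b with h3 | h3 <;> rcases le_total l a with h4 | h4 <;>
  simp [*] at * <;> grind

/-- The interval may straddle several steps, but each step meeting its interior has value `κ`, and
the others contribute nothing to the increment. -/
theorem IsStep.antideriv_sub_eq (hg : IsStep τ N c g) {I : BInterval} (hI : I.lo < I.hi)
    (hsub : I.carrier ⊆ Icc (τ 0) (τ N)) {κ : LC} (hκ : ∀ x ∈ I.carrier, g x = κ) :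
    stepAntideriv τ N c I.hi - stepAntideriv τ N c I.lo = κ * (I.hi - I.lo) := by
  obtain ⟨h1, h2⟩ := BInterval.mem_Icc_of_subset hI hsub
  have hlen : I.hi - I.lo = (I.hi - τ 0) - (I.lo - τ 0) := by ring
  rw [hlen, ← sum_min_sub (x := I.hi) ⟨h1.trans hI.le, h2⟩,
    ← sum_min_sub (x := I.lo) ⟨h1, hI.le.trans h2⟩]
  unfold stepAntideriv
  rw [← Finset.sum_sub_distrib, ← Finset.sum_sub_distrib, Finset.mul_sum]
  refine Finset.sum_congr rfl fun j hj => ?_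
  rw [← mul_sub]
  rcases le_or_gt (min I.hi (τ (j + 1))) (max I.lo (τ j)) with hle | hlt
  · rw [min_sub_min_eq hI.le (hg.mono j.le_succ) hle, sub_self, mul_zero, mul_zero]
  · obtain ⟨x, hx, hx'⟩ := exists_between hlt
    rw [← hκ x (I.Ioo_subset ⟨(le_max_left _ _).trans_lt hx, hx'.trans_le (min_le_left _ _)⟩),
      hg.eq j (Finset.mem_range.1 hj) x
        ⟨(le_max_right _ _).trans_lt hx, hx'.trans_le (min_le_right _ _)⟩]

/-- The values at the nodes are arbitrary, but there are only countably many nodes. -/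
theorem IsStep.countable_image (hg : IsStep τ N c g) : (g '' Icc (τ 0) (τ N)).Countable := by
  have hcov : Icc (τ 0) (τ N) ⊆ range τ ∪ ⋃ j ∈ Iio N, Ioo (τ j) (τ (j + 1)) := by
    intro x hx
    by_cases hxr : x ∈ range τ
    · exact Or.inl hxr
    right
    have hex : ∃ j, x ≤ τ j := ⟨N, hx.2⟩
    classical
    have h1 := Nat.find_spec hex
    have h0 : Nat.find hex ≠ 0 := fun h0 => by
      rw [h0] at h1
      exact hxr ⟨0, le_antisymm hx.1 h1⟩
    obtain ⟨j, hj⟩ := Nat.exists_eq_succ_of_ne_zero h0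
    have h2 := Nat.find_min hex (m := j) (by omega)
    have h3 := Nat.find_min' hex hx.2
    rw [hj] at h1
    exact mem_biUnion (show j ∈ Iio N by rw [mem_Iio]; omega)
      ⟨not_le.1 h2, h1.lt_of_ne fun h => hxr ⟨_, h.symm⟩⟩
  have hsub : g '' Icc (τ 0) (τ N) ⊆ g '' range τ ∪ range c := by
    rintro _ ⟨x, hx, rfl⟩
    rcases hcov hx with h | h
    · exact Or.inl ⟨x, h, rfl⟩
    · obtain ⟨j, hj, hxj⟩ := mem_iUnion₂.1 h
      exact Or.inr ⟨j, (hg.eq j hj x hxj).symm⟩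
  exact (((countable_range τ).image g).union (countable_range c)).mono hsub

/-- The sequence of the open intervals where a step function is constant. -/
def stepIntervals (hτ : Monotone τ) (N n : ℕ) : BInterval :=
  if n < N then ⟨τ n, τ (n + 1), hτ n.le_succ, Ioo (τ n) (τ (n + 1)), Or.inl rfl⟩
  else emptyInterval

theorem IsStep.isSimpleFamily (hg : IsStep τ N c g) :
    IsSimpleFamily (Icc (τ 0) (τ N)) g (stepIntervals hg.mono N) (τ N - τ 0) := by
  have hc : ∀ n, n < N → (stepIntervals hg.mono N n).carrier = Ioo (τ n) (τ (n + 1)) :=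
    fun n hn => by simp [stepIntervals, hn]
  have hc' : ∀ n, ¬ n < N → (stepIntervals hg.mono N n).carrier = ∅ :=
    fun n hn => by simp [stepIntervals, hn, emptyInterval_carrier]
  refine ⟨?_, ?_, ?_, ?_⟩
  · refine (pairwise_disjoint_on _).2 fun m n hmn => ?_
    by_cases hn : n < N
    · rw [hc n hn, hc m (hmn.trans hn), Set.disjoint_left]
      intro x hx hx'
      exact absurd (hx'.1.trans hx.2) (not_lt.2 (hg.mono hmn))
    · rw [hc' n hn]
      exact disjoint_empty _
  · refine iUnion_subset fun n => ?_
    by_cases hn : n < N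
    · rw [hc n hn]
      exact fun x hx => ⟨(hg.mono (Nat.zero_le n)).trans hx.1.le, hx.2.le.trans (hg.mono hn)⟩
    · rw [hc' n hn]
      exact empty_subset _
  · intro n
    refine isSimpleOn_const (κ := c n) fun x hx => ?_
    by_cases hn : n < N
    · rw [hc n hn] at hx
      exact hg.eq n hn x hx
    · rw [hc' n hn] at hx
      exact absurd hx (notMem_empty x)
  · have h1 := hasStrongSum_of_forall_ge (c := fun n => (stepIntervals hg.mono N n).length)
      (N := N) fun n hn => by simp [stepIntervals, not_lt.2 hn, emptyInterval_length]
    rwa [Finset.sum_congr rfl (g := fun n => τ (n + 1) - τ n), Finset.sum_range_sub] at h1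
    intro n hn
    simp [stepIntervals, Finset.mem_range.1 hn, BInterval.length]

theorem IsStep.mMeasurableFun (hg : IsStep τ N c g) : MMeasurableFun (Icc (τ 0) (τ N)) g :=
  ⟨_, hasMeasure_Icc (hg.mono (Nat.zero_le N)), fun ε hε => ⟨_, _, hg.isSimpleFamily, by
    rwa [sub_self]⟩⟩

/-- The definition tests every simple family, not only the natural one. On each member `g` is
constant, so the integrals are increments of the Lipschitz antiderivative; their sum converges
because the lengths tend to zero, and its error is at most `C` times the uncovered length, by
comparison for `Φ` and for `-Φ`. -/
theorem IsStep.hasIntegral (hg : IsStep τ N c g) : HasIntegral (Icc (τ 0) (τ N)) g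
    (∑ j ∈ Finset.range N, c j * (τ (j + 1) - τ j)) := by
  have hτ := hg.mono (Nat.zero_le N)
  refine ⟨hg.mMeasurableFun, _, hasMeasure_Icc hτ, fun ε hε => ?_⟩
  set C := ∑ j ∈ Finset.range N, |c j| * 2 with hC
  have hC0 : 0 ≤ C := Finset.sum_nonneg fun j _ => by positivity
  have hC1 : 0 < C + 1 := by linarith
  refine ⟨ε / (C + 1), div_pos hε hC1, fun I L hI hL => ?_⟩
  obtain ⟨hd, hU, hs, hlen⟩ := hI
  set Φ := stepAntideriv τ N c with hΦ
  have hint : ∀ n, HasSimpleIntegral g (I n) (Φ (I n).hi - Φ (I n).lo) := by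
    intro n
    rcases (I n).lo_le_hi.eq_or_lt with h | h
    · obtain ⟨x₀, a, ha⟩ := hs n
      exact ⟨x₀, a, ha, Or.inl ⟨h, by rw [h, sub_self]⟩⟩
    · have hsub := (subset_iUnion (fun n => (I n).carrier) n).trans hU
      obtain ⟨κ, hκ⟩ := (hs n).exists_eq_const h (hg.countable_image.mono (image_mono hsub))
      rw [hg.antideriv_sub_eq h hsub hκ]
      exact hasSimpleIntegral_const hκ h
  obtain ⟨w, hw⟩ := exists_hasStrongSum (c := fun n => Φ (I n).hi - Φ (I n).lo) fun η hη => by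
    obtain ⟨M, hM⟩ := hlen.exists_abs_lt (div_pos hη hC1)
    refine ⟨M, fun n hn => ?_⟩
    have h1 : |Φ (I n).hi - Φ (I n).lo| ≤ C * |(I n).length| := stepAntideriv_lipschitz _ _
    have h2 := (lt_div_iff₀ hC1).1 (hM n hn)
    linarith [abs_nonneg (I n).length]
  refine ⟨_, w, hint, hw, ?_⟩
  have hlip : ∀ x ∈ Icc (τ 0) (τ N), ∀ y ∈ Icc (τ 0) (τ N), |Φ x - Φ y| ≤ C * |x - y| :=
    fun x _ y _ => stepAntideriv_lipschitz x y
  have hlip' : ∀ x ∈ Icc (τ 0) (τ N), ∀ y ∈ Icc (τ 0) (τ N), |-Φ x - -Φ y| ≤ C * |x - y| := by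
    intro x hx y hy
    rw [← neg_sub_neg, neg_neg, neg_neg]
    simpa [abs_sub_comm] using hlip x hx y hy
  have h1 := sum_le_of_lipschitz hτ hlip hd hU (fun n => le_rfl) hw hlen
  have h2 := sum_le_of_lipschitz (Φ := fun x => -Φ x) hτ hlip' hd hU
    (c := fun n => -(Φ (I n).hi - Φ (I n).lo)) (fun n => by linarith) hw.neg hlen
  have h3 := (lt_div_iff₀ hC1).1 hL
  have h4 := length_le_of_subset hd hU hlen hτ
  rw [← stepAntideriv_sub hg.mono, abs_lt]
  constructor <;> linarith

theorem IsStep.abs (hg : IsStep τ N c g) : IsStep τ N (fun j => |c j|) fun x => |g x| :=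
  ⟨hg.mono, fun j hj x hx => by rw [hg.eq j hj x hx]⟩

theorem IsStep.memL1 (hg : IsStep τ N c g) : MemL1 (Icc (τ 0) (τ N)) g :=
  ⟨hg.mMeasurableFun, _, hg.abs.hasIntegral⟩

end

/-! ## Comparison with polynomials -/

open Polynomial in
/-- A real polynomial as a function on the Levi-Civita field. -/
def polyEval (p : ℝ[X]) (x : LC) : LC := p.eval₂ ofRealHom x

open Polynomial in
theorem polyEval_ofReal (p : ℝ[X]) (r : ℝ) : polyEval p (ofReal r) = ofReal (p.eval r) :=
  Polynomial.eval₂_at_apply ofRealHom r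

open Polynomial in
theorem polyEval_coeff (p : ℝ[X]) {x : LC} (hx : OrderGE 0 x) :
    OrderGE 0 (polyEval p x) ∧ coeff (polyEval p x) 0 = p.eval (coeff x 0) := by
  unfold polyEval
  induction p using Polynomial.induction_on' with
  | add p q hp hq =>
    rw [eval₂_add, eval_add, coeff_add, hp.2, hq.2]
    exact ⟨hp.1.add hq.1, rfl⟩
  | monomial n c =>
    rw [eval₂_monomial, eval_monomial, ofRealHom_apply, coeff_ofReal_mul, coeff_pow_zero hx]
    exact ⟨by simpa using (orderGE_ofReal c).mul (hx.pow n), rfl⟩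

open Polynomial in
theorem polyEval_lipschitz (p : ℝ[X]) (α β : LC) : ∃ C : LC, 0 ≤ C ∧
    ∀ x ∈ Icc α β, ∀ y ∈ Icc α β, |polyEval p x - polyEval p y| ≤ C * |x - y| := by
  unfold polyEval
  induction p using Polynomial.induction_on' with
  | add p q hp hq =>
    obtain ⟨C, hC, h1⟩ := hp
    obtain ⟨D, hD, h2⟩ := hq
    refine ⟨C + D, add_nonneg hC hD, fun x hx y hy => ?_⟩
    rw [eval₂_add, eval₂_add, add_sub_add_comm]
    linarith [abs_add_le (eval₂ ofRealHom x p - eval₂ ofRealHom y p)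
      (eval₂ ofRealHom x q - eval₂ ofRealHom y q), h1 x hx y hy, h2 x hx y hy]
  | monomial n c =>
    set B := max |α| |β| with hB
    have hB0 : 0 ≤ B := (abs_nonneg α).trans (le_max_left _ _)
    have hbd : ∀ x ∈ Icc α β, |x| ≤ B := fun x hx => abs_le_max_abs_abs hx.1 hx.2
    refine ⟨|ofReal c| * (n * B ^ (n - 1)), by positivity, fun x hx y hy => ?_⟩
    rw [eval₂_monomial, eval₂_monomial, ofRealHom_apply, ← mul_sub, abs_mul, mul_assoc]
    refine mul_le_mul_of_nonneg_left ?_ (abs_nonneg _)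
    refine (abs_pow_sub_pow_le x y n).trans ?_
    have h1 : max |x| |y| ^ (n - 1) ≤ B ^ (n - 1) :=
      pow_le_pow_left₀ ((abs_nonneg x).trans (le_max_left _ _)) (max_le (hbd x hx) (hbd y hy)) _
    have h2 := mul_le_mul_of_nonneg_left h1
      (mul_nonneg (abs_nonneg (x - y)) (Nat.cast_nonneg' n))
    linarith

open Polynomial in
theorem exists_derivative_eq (p : ℝ[X]) : ∃ q : ℝ[X], derivative q = p := by
  induction p using Polynomial.induction_on' with
  | add p q hp hq =>
    obtain ⟨P, rfl⟩ := hp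
    obtain ⟨Q, rfl⟩ := hq
    exact ⟨P + Q, derivative_add⟩
  | monomial n c =>
    refine ⟨Polynomial.monomial (n + 1) (c / (n + 1)), ?_⟩
    have : (n : ℝ) + 1 ≠ 0 := by positivity
    rw [derivative_monomial, Nat.add_sub_cancel, Nat.cast_add_one, div_mul_cancel₀ _ this]

theorem TendstoWithin.sub {F G : LC → LC} {S : Set LC} {p l k : LC} (hF : TendstoWithin F S p l)
    (hG : TendstoWithin G S p k) : TendstoWithin (fun x => F x - G x) S p (l - k) := by
  intro ε hε
  obtain ⟨δ, hδ, h1⟩ := hF (ε / 2) (half_pos hε)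
  obtain ⟨δ', hδ', h2⟩ := hG (ε / 2) (half_pos hε)
  refine ⟨min δ δ', lt_min hδ hδ', fun x hx h0 hlt => ?_⟩
  have h3 := h1 x hx h0 (hlt.trans_le (min_le_left _ _))
  have h4 := h2 x hx h0 (hlt.trans_le (min_le_right _ _))
  rw [show F x - G x - (l - k) = (F x - l) - (G x - k) by ring]
  linarith [abs_sub (F x - l) (G x - k)]

open Polynomial in
-- A polynomial can be expanded about whatever centre the series of `g` has, so the two series can
-- be subtracted term by term.
theorem hasWeakSum_taylor (p : LC[X]) (x₀ x : LC) :
    HasWeakSum (fun n => (taylor x₀ p).coeff n * (x - x₀) ^ n) (p.eval x) := by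
  have h := hasWeakSum_of_forall_ge (c := fun n => (taylor x₀ p).coeff n * (x - x₀) ^ n)
    (N := (taylor x₀ p).natDegree + 1) fun n hn => by
      rw [coeff_eq_zero_of_natDegree_lt (by omega), zero_mul]
  rwa [← eval_eq_sum_range, taylor_eval_sub] at h

open Polynomial in
-- The prescribed antiderivative vanishes at the centre, hence the subtracted constant term.
theorem hasWeakSum_taylor_antideriv {p q : LC[X]} (hq : derivative q = p) (x₀ x : LC) :
    HasWeakSum (fun n => (taylor x₀ p).coeff n / ((n : LC) + 1) * (x - x₀) ^ (n + 1))
      (q.eval x - (taylor x₀ q).coeff 0) := by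
  have hcoeff : ∀ n, (taylor x₀ p).coeff n / ((n : LC) + 1) = (taylor x₀ q).coeff (n + 1) := by
    intro n
    have hne : (n : LC) + 1 ≠ 0 := by positivity
    have h1 : taylor x₀ p = derivative (taylor x₀ q) := by
      rw [← hq, taylor_apply, taylor_apply, derivative_comp]
      simp
    rw [h1, coeff_derivative, mul_div_assoc, div_self hne, mul_one]
  simp only [hcoeff]
  have h := hasWeakSum_of_forall_ge
    (c := fun n => (taylor x₀ q).coeff (n + 1) * (x - x₀) ^ (n + 1))
    (N := (taylor x₀ q).natDegree) fun n hn => by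
      rw [coeff_eq_zero_of_natDegree_lt (by omega), zero_mul]
  have heval : q.eval x = ∑ n ∈ Finset.range (taylor x₀ q).natDegree,
      (taylor x₀ q).coeff (n + 1) * (x - x₀) ^ (n + 1) + (taylor x₀ q).coeff 0 := by
    rw [← taylor_eval_sub x₀, eval_eq_sum_range, Finset.sum_range_succ', pow_zero, mul_one]
  rwa [heval, add_sub_cancel_right]

open Polynomial in
-- The difference `polyEval p - g` is a nonnegative power series about the centre used for `g`, and
-- `IsPowerSeriesOn.antideriv_le` applies to it.
theorem HasSimpleIntegral.le_poly {g : LC → LC} {I : BInterval} {v : LC}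
    (hv : HasSimpleIntegral g I v) {p q : ℝ[X]} (hq : derivative q = p)
    (hle : ∀ x ∈ I.carrier, g x ≤ polyEval p x) : v ≤ polyEval q I.hi - polyEval q I.lo := by
  obtain ⟨x₀, a, ha, h | ⟨hI, F, u, w, hF, hu, hw, rfl⟩⟩ := hv
  · rw [h.2, h.1, sub_self]
  have hq' : derivative (q.map ofRealHom) = p.map ofRealHom := by rw [derivative_map, hq]
  have heval : ∀ (r : ℝ[X]) x, (r.map ofRealHom).eval x = polyEval r x := fun r x =>
    eval_map ofRealHom x
  obtain ⟨C, -, hC⟩ := polyEval_lipschitz q I.lo I.hi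
  set A : ℕ → LC := (taylor x₀ (p.map ofRealHom)).coeff with hA
  set b := (taylor x₀ (q.map ofRealHom)).coeff 0 with hb
  have hps : IsPowerSeriesOn (fun x => polyEval p x - g x) I x₀ fun n => A n - a n :=
    ⟨ha.1, fun x hx => by
      simpa only [sub_mul, heval] using (hasWeakSum_taylor (p.map ofRealHom) x₀ x).sub (ha.2 x hx)⟩
  have hG : ∀ x ∈ I.carrier, HasWeakSum (fun n => (A n - a n) / ((n : LC) + 1) *
      (x - x₀) ^ (n + 1)) (polyEval q x - b - F x) := fun x hx => by
    simpa only [sub_mul, sub_div, heval] using (hasWeakSum_taylor_antideriv hq' x₀ x).sub (hF x hx)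
  have hT : ∀ z ∈ Icc I.lo I.hi,
      TendstoWithin (fun x => polyEval q x - b) I.carrier z (polyEval q z - b) := fun z hz =>
    tendstoWithin_of_lipschitz (C := C) fun x hx => by
      rw [sub_sub_sub_cancel_right]
      exact hC x (I.subset_Icc hx) z hz
  have := hps.antideriv_le hI (fun x hx => sub_nonneg.2 (hle x hx)) hG
    ((hT _ ⟨le_rfl, hI.le⟩).sub hu) ((hT _ ⟨hI.le, le_rfl⟩).sub hw)
  linarith

open Polynomial in
theorem HasIntegral.le_poly {g : LC → LC} {α β v : LC} (hαβ : α ≤ β)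
    (hv : HasIntegral (Icc α β) g v) {p q : ℝ[X]} (hq : derivative q = p)
    (hle : ∀ x ∈ Icc α β, g x ≤ polyEval p x) : v ≤ polyEval q β - polyEval q α := by
  obtain ⟨⟨m', hm', hmeas⟩, m, hm, hint⟩ := hv
  rw [hm'.unique (hasMeasure_Icc hαβ)] at hmeas
  rw [hm.unique (hasMeasure_Icc hαβ)] at hint
  obtain ⟨C, hC0, hC⟩ := polyEval_lipschitz q α β
  have hC1 : 0 < C + 1 := by linarith
  refine le_of_forall_pos_le_add fun ε hε => ?_
  obtain ⟨δ, hδ, h1⟩ := hint (ε / 2) (half_pos hε)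
  -- One family serves two purposes: its sum is within `ε / 2` of `v`, and the uncovered length
  -- costs at most `ε / 2` in the Lipschitz comparison.
  obtain ⟨I, L, hI, hL⟩ := hmeas (min δ (ε / 2 / (C + 1)))
    (lt_min hδ (div_pos (half_pos hε) hC1))
  obtain ⟨c, w, hc, hw, hwv⟩ := h1 I L hI (hL.trans_le (min_le_left _ _))
  obtain ⟨hd, hU, hs, hlen⟩ := hI
  have h2 := sum_le_of_lipschitz hαβ hC hd hU (fun n => (hc n).le_poly hq fun x hx =>
    hle x (hU (mem_iUnion.2 ⟨n, hx⟩))) hw hlen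
  have h3 := (lt_div_iff₀ hC1).1 (hL.trans_le (min_le_right _ _))
  have h4 := length_le_of_subset hd hU hlen hαβ
  linarith [(abs_lt.1 hwv).1]

/-! ## Negation -/

theorem IsPowerSeriesOn.neg {g : LC → LC} {I : BInterval} {x₀ : LC} {a : ℕ → LC}
    (h : IsPowerSeriesOn g I x₀ a) : IsPowerSeriesOn (fun x => -g x) I x₀ fun n => -a n :=
  ⟨h.1, fun x hx => by simpa only [neg_mul] using (h.2 x hx).neg⟩

theorem TendstoWithin.neg {F : LC → LC} {S : Set LC} {p l : LC} (h : TendstoWithin F S p l) :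
    TendstoWithin (fun x => -F x) S p (-l) := fun ε hε => by
  obtain ⟨δ, hδ, h1⟩ := h ε hε
  refine ⟨δ, hδ, fun x hx h0 hlt => ?_⟩
  rw [show -F x - -l = -(F x - l) by ring, abs_neg]
  exact h1 x hx h0 hlt

theorem HasSimpleIntegral.neg {g : LC → LC} {I : BInterval} {v : LC}
    (h : HasSimpleIntegral g I v) : HasSimpleIntegral (fun x => -g x) I (-v) := by
  obtain ⟨x₀, a, ha, h | ⟨hI, F, u, w, hF, hu, hw, rfl⟩⟩ := h
  · exact ⟨x₀, _, ha.neg, Or.inl ⟨h.1, by rw [h.2, neg_zero]⟩⟩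
  · exact ⟨x₀, _, ha.neg, Or.inr ⟨hI, fun x => -F x, -u, -w, fun x hx => by
      simpa only [neg_mul, neg_div] using (hF x hx).neg, hu.neg, hw.neg, by ring⟩⟩

theorem IsSimpleFamily.neg {A : Set LC} {g : LC → LC} {I : ℕ → BInterval} {L : LC}
    (h : IsSimpleFamily A g I L) : IsSimpleFamily A (fun x => -g x) I L :=
  ⟨h.1, h.2.1, fun n => by
    obtain ⟨x₀, a, ha⟩ := h.2.2.1 n
    exact ⟨x₀, _, ha.neg⟩, h.2.2.2⟩

theorem MMeasurableFun.neg {A : Set LC} {g : LC → LC} (h : MMeasurableFun A g) :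
    MMeasurableFun A fun x => -g x := by
  obtain ⟨m, hm, h⟩ := h
  refine ⟨m, hm, fun ε hε => ?_⟩
  obtain ⟨I, L, hI, hL⟩ := h ε hε
  exact ⟨I, L, hI.neg, hL⟩

theorem HasIntegral.neg {A : Set LC} {g : LC → LC} {v : LC} (h : HasIntegral A g v) :
    HasIntegral A (fun x => -g x) (-v) := by
  obtain ⟨hmeas, m, hm, h⟩ := h
  refine ⟨hmeas.neg, m, hm, fun ε hε => ?_⟩
  obtain ⟨δ, hδ, h⟩ := h ε hε
  refine ⟨δ, hδ, fun I L hI hL => ?_⟩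
  obtain ⟨c, w, hc, hw, hwv⟩ := h I L (by simpa only [neg_neg] using hI.neg) hL
  refine ⟨_, -w, fun n => (hc n).neg, hw.neg, ?_⟩
  rwa [show -w - -v = -(w - v) by ring, abs_neg]

theorem MemL1.neg {A : Set LC} {g : LC → LC} (h : MemL1 A g) : MemL1 A fun x => -g x :=
  ⟨h.1.neg, by simpa only [abs_neg] using h.2⟩

/-! ## The real-valued integral of functions infinitely close to a continuous function -/

section Close

variable {a b : ℝ} {f : ℝ → ℝ} {F : LC → LC}

/-- `F` is finite and infinitely close to `f` on the interval between `a` and `b`. -/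
def CloseOn (a b : ℝ) (f : ℝ → ℝ) (F : LC → LC) : Prop :=
  ∀ x ∈ Icc (ofReal a) (ofReal b), OrderGE 0 (F x) ∧ coeff (F x) 0 = f (coeff x 0)

theorem CloseOn.neg (h : CloseOn a b f F) : CloseOn a b (fun x => -f x) fun x => -F x :=
  fun x hx => ⟨(h x hx).1.neg, by rw [coeff_neg, (h x hx).2]⟩

/-- A continuous function on a compact interval has lower Riemann sums close to its integral. -/
theorem exists_lower_sum (hab : a < b) (hf : ContinuousOn f (Icc a b)) {e : ℝ} (he : 0 < e) :
    ∃ (t : ℕ → ℝ) (N : ℕ) (c : ℕ → ℝ), Monotone t ∧ t 0 = a ∧ t N = b ∧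
      (∀ j < N, ∀ s ∈ Icc (t j) (t (j + 1)), c j < f s) ∧
      ∫ x in a..b, f x ≤ ∑ j ∈ Finset.range N, c j * (t (j + 1) - t j) + e := by
  -- On each piece `f` exceeds the chosen lower value `f (t j) - e'` by at most `2 * e'`, for a
  -- total of `e`.
  set e' := e / (2 * (b - a)) with he'
  have hba : 0 < b - a := sub_pos.2 hab
  have he0 : 0 < e' := by positivity
  obtain ⟨δ, hδ, hδ'⟩ := Metric.uniformContinuousOn_iff.1
    (isCompact_Icc.uniformContinuousOn_of_continuous hf) e' he0
  obtain ⟨N, hN⟩ := exists_nat_gt ((b - a) / δ)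
  have hN0 : (0 : ℝ) < N := (div_pos hba hδ).trans hN
  have hstep : (b - a) / N < δ := by
    rw [div_lt_iff₀ hδ] at hN
    rw [div_lt_iff₀ hN0]
    linarith
  set t : ℕ → ℝ := fun j => a + (b - a) / N * j with ht
  have htm : Monotone t := fun i j hij => by
    have : (i : ℝ) ≤ j := by exact_mod_cast hij
    have h2 : 0 ≤ (b - a) / N := (div_pos hba hN0).le
    simp only [ht]
    gcongr
  have ht0 : t 0 = a := by simp [ht]
  have htN : t N = b := by simp only [ht]; field_simp; ring
  have hlen : ∀ j, t (j + 1) - t j = (b - a) / N := fun j => by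
    simp only [ht]; push_cast; ring
  have hosc : ∀ j < N, ∀ s ∈ Icc (t j) (t (j + 1)), |f s - f (t j)| < e' := by
    intro j hj s hs
    have h1 : a ≤ t j := ht0 ▸ htm (Nat.zero_le j)
    have h2 : t (j + 1) ≤ b := htN ▸ htm hj
    refine hδ' s ⟨h1.trans hs.1, hs.2.trans h2⟩ (t j) ⟨h1, (hs.1.trans hs.2).trans h2⟩ ?_
    rw [Real.dist_eq, abs_of_nonneg (sub_nonneg.2 hs.1)]
    linarith [hs.2, hlen j]
  have hint : ∀ j < N, IntervalIntegrable f MeasureTheory.volume (t j) (t (j + 1)) := by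
    intro j hj
    refine (hf.mono ?_).intervalIntegrable_of_Icc (htm j.le_succ)
    exact Icc_subset_Icc (ht0 ▸ htm (Nat.zero_le j)) (htN ▸ htm hj)
  refine ⟨t, N, fun j => f (t j) - e', htm, ht0, htN, fun j hj s hs => ?_, ?_⟩
  · linarith [(abs_lt.1 (hosc j hj s hs)).1]
  · have h1 := intervalIntegral.sum_integral_adjacent_intervals hint
    rw [ht0, htN] at h1
    rw [← h1]
    have h2 : ∑ j ∈ Finset.range N, ∫ x in t j..t (j + 1), f x ≤
        ∑ j ∈ Finset.range N, ((f (t j) - e') * (t (j + 1) - t j) +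
          2 * e' * (t (j + 1) - t j)) := by
      refine Finset.sum_le_sum fun j hj => ?_
      have hj := Finset.mem_range.1 hj
      have h3 := intervalIntegral.integral_mono_on (htm j.le_succ) (hint j hj)
        (intervalIntegrable_const (c := f (t j) + e')) fun s hs => by
          linarith [(abs_lt.1 (hosc j hj s hs)).2]
      rw [intervalIntegral.integral_const, smul_eq_mul] at h3
      linarith
    rw [Finset.sum_add_distrib, ← Finset.mul_sum, Finset.sum_range_sub, ht0, htN] at h2
    have h4 : 2 * e' * (b - a) = e := by rw [he']; field_simp
    linarith

/-- A strict inequality between reals survives infinitesimal perturbation, so a step function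
strictly below `f` lies below `F`. -/
theorem CloseOn.exists_le (hab : a < b) (hf : ContinuousOn f (Icc a b)) (hF : CloseOn a b f F)
    {e : ℝ} (he : 0 < e) : ∃ (g : LC → LC) (r : ℝ), MemL1 (Icc (ofReal a) (ofReal b)) g ∧
      HasIntegral (Icc (ofReal a) (ofReal b)) g (ofReal r) ∧
      (∀ x ∈ Icc (ofReal a) (ofReal b), g x ≤ F x) ∧ ∫ x in a..b, f x ≤ r + e := by
  obtain ⟨t, N, c, htm, ht0, htN, hc, hint⟩ := exists_lower_sum hab hf he
  obtain ⟨M, hM⟩ := (isCompact_Icc.image_of_continuousOn hf).bddBelow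
  classical
  -- Off the open steps the value is `M - 1`, strictly below the lower bound `M` of `f`.
  set g : LC → LC := fun x => if h : ∃ j < N, x ∈ Ioo (ofReal (t j)) (ofReal (t (j + 1)))
    then ofReal (c h.choose) else ofReal (M - 1) with hg
  have hτ : Monotone fun j => ofReal (t j) := ofReal_strictMono.monotone.comp htm
  have hstep : IsStep (fun j => ofReal (t j)) N (fun j => ofReal (c j)) g := by
    refine ⟨hτ, fun j hj x hx => ?_⟩
    have h : ∃ j < N, x ∈ Ioo (ofReal (t j)) (ofReal (t (j + 1))) := ⟨j, hj, hx⟩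
    have hne : ∀ i k, x ∈ Ioo (ofReal (t i)) (ofReal (t (i + 1))) →
        x ∈ Ioo (ofReal (t k)) (ofReal (t (k + 1))) → ¬ i < k := fun i k hi hk hlt =>
      absurd (hk.1.trans hi.2) (not_lt.2 (hτ hlt))
    have heq : h.choose = j := le_antisymm (not_lt.1 (hne _ _ hx h.choose_spec.2))
      (not_lt.1 (hne _ _ h.choose_spec.2 hx))
    simp only [hg, dif_pos h, heq]
  have h1 := hstep.memL1
  have h2 := hstep.hasIntegral
  simp only [ht0, htN, ← ofReal_sub, ← ofReal_mul, ← ofReal_sum] at h1 h2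
  refine ⟨g, _, h1, h2, fun x hx => ?_, hint⟩
  obtain ⟨hF1, hF2⟩ := hF x hx
  by_cases h : ∃ j < N, x ∈ Ioo (ofReal (t j)) (ofReal (t (j + 1)))
  · obtain ⟨j, hj, hxj⟩ := id h
    rw [hstep.eq j hj x hxj]
    refine (ofReal_lt_of_lt_coeff hF1 ?_).le
    rw [hF2]
    -- The real part of a point of an open step may be a node, which is why the lower sum is
    -- controlled on closed pieces.
    exact hc j hj _ (coeff_mem_Icc ⟨hxj.1.le, hxj.2.le⟩)
  · simp only [hg, dif_neg h]
    refine (ofReal_lt_of_lt_coeff hF1 ?_).le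
    rw [hF2]
    linarith [hM (mem_image_of_mem f (coeff_mem_Icc hx))]

open Polynomial in
theorem CloseOn.integral_le (hab : a < b) (hf : ContinuousOn f (Icc a b)) (hF : CloseOn a b f F)
    {g : LC → LC} {v : LC} (hv : HasIntegral (Icc (ofReal a) (ofReal b)) g v)
    (hg : ∀ x ∈ Icc (ofReal a) (ofReal b), g x ≤ F x) {e : ℝ} (he : 0 < e) :
    v ≤ ofReal ((∫ x in a..b, f x) + e) := by
  have hba : 0 < b - a := sub_pos.2 hab
  set e' := e / (2 * (b - a)) with he'
  obtain ⟨p, hp⟩ := exists_polynomial_near_of_continuousOn a b f hf e' (by positivity)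
  -- The shift gives `f < P < f + 2 * e'`: strictness puts `P` above `F`, and the excess integrates
  -- to at most `e`.
  set P := p + C e' with hP
  have hPe : ∀ x, P.eval x = p.eval x + e' := fun x => by simp [hP]
  obtain ⟨q, hq⟩ := exists_derivative_eq P
  have h1 := hv.le_poly (ofReal_le.2 hab.le) hq fun x hx => by
    obtain ⟨h1, h2⟩ := hF x hx
    obtain ⟨h3, h4⟩ := polyEval_coeff P (orderGE_of_mem_Icc hx)
    refine (hg x hx).trans (sub_pos.1 (pos_of_coeff_pos (h3.sub h1) ?_)).le
    rw [coeff_sub, h2, h4, hPe]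
    linarith [(abs_lt.1 (hp _ (coeff_mem_Icc hx))).1]
  rw [polyEval_ofReal, polyEval_ofReal, ← ofReal_sub] at h1
  refine h1.trans (ofReal_le.2 ?_)
  have h2 : ∫ x in a..b, P.eval x = q.eval b - q.eval a := by
    refine intervalIntegral.integral_eq_sub_of_hasDerivAt (f := fun x => q.eval x) (fun x _ => ?_)
      (P.continuous.intervalIntegrable _ _)
    rw [← hq]
    exact q.hasDerivAt x
  have h3 := intervalIntegral.integral_mono_on (μ := MeasureTheory.volume)
    (f := fun x => P.eval x) (g := fun x => f x + 2 * e') hab.le (P.continuous.intervalIntegrable a b)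
    ((hf.intervalIntegrable_of_Icc hab.le).add (intervalIntegrable_const (c := 2 * e')))
    fun x hx => by
      rw [hPe]
      linarith [(abs_lt.1 (hp x hx)).2]
  rw [intervalIntegral.integral_add (hf.intervalIntegrable_of_Icc hab.le) intervalIntegrable_const,
    intervalIntegral.integral_const, smul_eq_mul, h2] at h3
  have h4 : (b - a) * (2 * e') = e := by rw [he']; field_simp
  linarith

theorem CloseOn.lowerIntegral_eq (hab : a < b) (hf : ContinuousOn f (Icc a b))
    (hF : CloseOn a b f F) : lowerIntegral (Icc (ofReal a) (ofReal b)) F =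
      ((∫ x in a..b, f x : ℝ) : EReal) := by
  apply le_antisymm
  · refine sSup_le ?_
    rintro y ⟨g, v, -, hv, hg, rfl⟩
    refine EReal.le_of_forall_lt_iff_le.1 fun z hz => ?_
    have hz := EReal.coe_lt_coe_iff.1 hz
    have := sh_mono (hF.integral_le hab hf hv hg (sub_pos.2 hz))
    rwa [add_sub_cancel, sh_ofReal] at this
  · refine EReal.ge_of_forall_gt_iff_ge.1 fun z hz => ?_
    have hz := EReal.coe_lt_coe_iff.1 hz
    obtain ⟨g, r, h1, h2, h3, h4⟩ := hF.exists_le hab hf (sub_pos.2 hz)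
    refine le_sSup_of_le ⟨g, _, h1, h2, h3, rfl⟩ ?_
    rw [sh_ofReal]
    exact EReal.coe_le_coe_iff.2 (by linarith)

theorem CloseOn.upperIntegral_eq (hab : a < b) (hf : ContinuousOn f (Icc a b))
    (hF : CloseOn a b f F) : upperIntegral (Icc (ofReal a) (ofReal b)) F =
      ((∫ x in a..b, f x : ℝ) : EReal) := by
  have hI : ∫ x in a..b, (-f) x = -∫ x in a..b, f x := intervalIntegral.integral_neg
  apply le_antisymm
  · refine EReal.le_of_forall_lt_iff_le.1 fun z hz => ?_
    have hz := EReal.coe_lt_coe_iff.1 hz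
    obtain ⟨g, r, h1, h2, h3, h4⟩ := hF.neg.exists_le hab hf.neg (sub_pos.2 hz)
    refine sInf_le_of_le ⟨fun x => -g x, _, h1.neg, h2.neg,
      fun x hx => by linarith [h3 x hx], rfl⟩ ?_
    rw [← ofReal_neg, sh_ofReal]
    rw [hI] at h4
    exact EReal.coe_le_coe_iff.2 (by linarith)
  · refine le_sInf ?_
    rintro y ⟨g, v, -, hv, hg, rfl⟩
    refine EReal.ge_of_forall_gt_iff_ge.1 fun z hz => ?_
    have hz := EReal.coe_lt_coe_iff.1 hz
    have h1 := hF.neg.integral_le hab hf.neg hv.neg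
      (fun x hx => neg_le_neg (hg x hx)) (sub_pos.2 hz)
    rw [hI, show (-∫ x in a..b, f x) + ((∫ x in a..b, f x) - z) = -z by ring, ofReal_neg] at h1
    have := sh_mono (neg_le_neg_iff.1 h1)
    rwa [sh_ofReal] at this

theorem CloseOn.boundedOn (hf : ContinuousOn f (Icc a b)) (hF : CloseOn a b f F) :
    BoundedOn (Icc (ofReal a) (ofReal b)) F := by
  obtain ⟨M, hM⟩ := isCompact_Icc.exists_bound_of_continuousOn hf
  refine ⟨ofReal (M + 1), fun x hx => ?_⟩
  obtain ⟨h1, h2⟩ := hF x hx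
  have h3 := abs_le.1 (hM _ (coeff_mem_Icc hx))
  refine abs_le.2 ⟨?_, (lt_ofReal_of_coeff_lt h1 (by rw [h2]; linarith [h3.2])).le⟩
  rw [← ofReal_neg]
  exact (ofReal_lt_of_lt_coeff h1 (by rw [h2]; linarith [h3.1])).le

end Close

/-! ## Taylor extensions -/

/-- Since `x - r` has only positive exponents, say at least `s`, the `n`-th term has exponents at
least `n * s`. The series therefore converges, and only its zeroth term `f r` reaches exponents `≤
0`. -/
theorem closeOn_ext (a b : ℝ) (h : ℕ∞) (f : ℝ → ℝ) : CloseOn a b f (ext a b h f) := by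
  intro x hx
  have hx0 := orderGE_of_mem_Icc hx
  have hsh : (sh x).toReal = coeff x 0 := by rw [sh_eq_coeff hx0, EReal.toReal_coe]
  unfold ext
  rw [hsh]
  set r := coeff x 0 with hr
  set c : ℕ → LC := fun i => if (i : ℕ∞) ≤ h then
    ofReal (iteratedDerivWithin i f (Icc a b) r / (i.factorial : ℝ)) * (x - ofReal r) ^ i
    else 0 with hc
  obtain ⟨s, hs, hsx⟩ : ∃ s : ℚ, 0 < s ∧ OrderGE s (x - ofReal r) := by
    by_cases h0 : x - ofReal r = 0
    · exact ⟨1, one_pos, h0 ▸ orderGE_zero 1⟩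
    · obtain ⟨q, hq, hq0⟩ := exists_orderGE h0
      refine ⟨q, ?_, hq⟩
      by_contra hle
      rcases (not_lt.1 hle).eq_or_lt with rfl | hlt
      · simp [hr] at hq0
      · exact hq0 ((hx0.sub (orderGE_ofReal r)) q hlt)
  have hpow : ∀ n : ℕ, OrderGE (n * s) ((x - ofReal r) ^ n) := by
    intro n
    induction n with
    | zero => simpa using orderGE_ofReal 1
    | succ n ih =>
      rw [pow_succ, Nat.cast_add_one, add_mul, one_mul]
      exact ih.mul hsx
  have hterm : ∀ n : ℕ, OrderGE (n * s) (c n) := by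
    intro n
    simp only [hc]
    split_ifs
    · simpa using (orderGE_ofReal _).mul (hpow n)
    · exact orderGE_zero _
  have hex : ∃ l, HasWeakSum c l := by
    obtain ⟨l, hl⟩ := exists_sum_of_orderGE (c := c) fun Q => by
      obtain ⟨N, hN⟩ := exists_nat_ge (Q / s)
      refine ⟨N, fun n hn => (hterm n).mono ?_⟩
      have : (N : ℚ) ≤ n := by exact_mod_cast hn
      exact (div_le_iff₀ hs).1 (hN.trans this)
    exact ⟨l, weakLim_of_orderGE hl⟩
  -- Convergence rules out the default value of `weakSum`.
  have hsum : HasWeakSum c (weakSum c) := by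
    rw [weakSum, dif_pos hex]
    exact hex.choose_spec
  have hc0 : c 0 = ofReal (f r) := by simp [hc]
  have hlow : ∀ q ≤ 0, coeff (weakSum c) q = coeff (c 0) q := by
    intro q hq
    refine tendsto_nhds_unique (hsum.tendsto_coeff q) (tendsto_const_nhds.congr' ?_)
    filter_upwards [eventually_ge_atTop 1] with m hm
    refine (Finset.sum_eq_single_of_mem (f := fun n => coeff (c n) q) 0 (Finset.mem_range.2 hm) fun n _ hn => ?_).symm
    refine hterm n q (hq.trans_lt (mul_pos ?_ hs))
    exact_mod_cast Nat.pos_of_ne_zero hn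
  refine ⟨fun q hq => ?_, ?_⟩
  · rw [hlow q hq.le, hc0, orderGE_ofReal _ q hq]
  · rw [hlow 0 le_rfl, hc0, coeff_ofReal_zero]

end LC

end

/-! ### The integral of the Taylor extension -/

theorem mainTheorem8 (a b : ℝ) (hab : a < b) (k h : ℕ∞) (hhk : h ≤ k) (f : ℝ → ℝ)
    (hf : ContDiffOn ℝ k f (Icc a b)) :
    LC.MIntegrable (Icc (LC.ofReal a) (LC.ofReal b)) (LC.ext a b h f) ∧
      LC.mIntegral (Icc (LC.ofReal a) (LC.ofReal b)) (LC.ext a b h f) =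
        ((∫ x in Icc a b, f x : ℝ) : EReal) := by
  have hcont := hf.continuousOn
  have hF := LC.closeOn_ext a b h f
  have hbd := hF.boundedOn hcont
  have hlower := hF.lowerIntegral_eq hab hcont
  have hupper := hF.upperIntegral_eq hab hcont
  refine ⟨⟨(LC.hasMeasure_Icc (LC.ofReal_le.2 hab.le)).1,
    fun _ => ⟨fun _ => hlower.trans hupper.symm, fun hn => absurd hbd hn⟩,
    fun hn => absurd hbd hn⟩, ?_⟩
  rw [LC.mIntegral, if_pos hbd, hlower, intervalIntegral.integral_of_le hab.le,
    MeasureTheory.integral_Icc_eq_integral_Ioc]
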